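/- **Setting.** A *time warp* is a supremum-preserving map $p:\omega+1\to\omega+1$, where $\omega+1=\{0,1,2,\dots,\omega\}$. Time warps are ordered pointwise, and $p*q:=q\circ p$. The warps $\underline{id}$, $\underline{-1}$, $\underline{\omega}$ send $0<n<\omega$ to $n$, $n-1$, $\omega$ respectively. Fix a set $G$ of ground types and pairwise disjoint sets $(S_\nu)_{\nu\in G}$ of scalars. *Types*: $\tau::=\nu\mid \mathsf{Str}\,\tau\mid\tau\to\tau\mid\tau\times\tau\mid\tau+\tau\mid *_p\tau$, with $p$ a time warp. *Coercions* $\alpha:\tau<:\tau'$ are generated by: identity $\mathsf{id}:\tau<:\tau$; composition $\alpha_1;\alpha_2$; congruences for $\mathsf{Str}$, $\to$ (contravariant on the left), $\times$, $+$ and $*_p$; $\mathsf{wrap}:\tau<:*_{\underline{id}}\tau$ and its reverse $\mathsf{unwrap}$; $\mathsf{concat}^{p,q}:*_p*_q\tau<:*_{p*q}\tau$ and its reverse $\mathsf{decat}^{p,q}$; $\mathsf{inflate}:\nu<:*_{\underline\omega}\nu$; $\mathsf{dist}_\times:*_p(\tau_1\times\tau_2)<:*_p\tau_1\times *_p\tau_2$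 and its reverse $\mathsf{fact}_\times$; $\mathsf{delay}^{p,q}:*_p\tau<:*_q\tau$ when $q\le p$. A *context coercion* $\beta$ is a finite partial map from variables to coercions; $\beta:\Gamma<:\Gamma'$ means that $\Gamma,\Gamma'$ have the same variables, all in the domain of $\beta$, and $\beta(x):\Gamma(x)<:\Gamma'(x)$ for each of them. *Implicit terms* $t$ (up to renaming of bound variables) are built from variables, $\mathsf{fun}(x:\tau).t$, $t_1\,t_2$, pairs, projections, injections annotated with the other summand, $\mathsf{case}$, $\mathsf{head}\,t$, $\mathsf{tail}\,t$, $t_1::t_2$, scalars, $\mathsf{rec}(x:\tau).t$ and $t\,\mathsf{by}\,p$. *Explicit terms* $e$ have in addition the forms $e;\alpha$ and $\beta;e$. An explicit term $e$ *refines* $t$ if erasing all coercions from $e$ gives $t$. The judgment $\Gamma\vdash e:\tau$ is generated by the usual rules for variables ($\Gamma,x:\tau\vdash x:\tau$), functions, products, sums and scalars, and by: - if $\Gamma\vdash e:\mathsf{Str}\,\tau$, then $\Gamma\vdash\mathsf{head}\,e:\tau$ and $\Gamma\vdash\mathsf{tail}\,e:*_{\underline{-1}}\mathsf{Str}\,\tau$;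 - if $\Gamma\vdash e_1:\tau$ and $\Gamma\vdash e_2:*_{\underline{-1}}\mathsf{Str}\,\tau$, then $\Gamma\vdash e_1::e_2:\mathsf{Str}\,\tau$; - if $\Gamma,x:*_{\underline{-1}}\tau\vdash e:\tau$, then $\Gamma\vdash\mathsf{rec}(x:\tau).e:\tau$; - if $\Gamma\vdash e:\tau$, then $*_p\Gamma\vdash e\,\mathsf{by}\,p:*_p\tau$; - if $\Gamma\vdash e:\tau$ and $\alpha:\tau<:\tau'$, then $\Gamma\vdash e;\alpha:\tau'$; - if $\beta:\Gamma<:\Gamma'$ and $\Gamma'\vdash e:\tau$, then $\Gamma\vdash\beta;e:\tau$; - if $\Gamma\vdash e:\tau$ and $\sigma$ is a map from the variables of $\Gamma$ to those of $\Gamma'$ with $\Gamma'(\sigma(x))=\Gamma(x)$ for all $x$, then $\Gamma'\vdash\sigma[e]:\tau$, where $\sigma[e]$ renames the free variables of $e$ along $\sigma$ (a context coercion $\beta$ becomes $\{\sigma(x)\mapsto\beta(x)\}$; the rule applies when these are again partial maps). *Denotations* live in the topos of trees, the category of presheaves of sets on the ordered set $\{1,2,3,\dots\}$. Ground types denote constant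 presheaves; $\times,+,\to$ denote products, coproducts and exponentials; $[\![*_p\tau]\!](n)$ is the set of families $(x_m)_{1\le m\le p(n),\,m<\omega}$, $x_m\in[\![\tau]\!](m)$, compatible with restriction; $[\![\mathsf{Str}\,\tau]\!](n)=\prod_{m=1}^n[\![\tau]\!](m)$, the head of a prefix being its component at $m=n$ and its tail the remaining components, with restriction from $n+1$ to $n$ acting elementwise and dropping the last element of the prefix; contexts denote products of their types. Coercions denote the functorial actions of the type formers, composites, and the canonical maps: the isomorphisms $X\cong *_{\underline{id}}X$, $*_p*_qX\cong *_{p*q}X$, $*_p(X\times Y)\cong *_pX\times *_pY$ and $\Delta A\cong *_{\underline\omega}\Delta A$ (with $\Delta A$ the constant presheaf on a set $A$), and, for $q\le p$, the restriction $*_pX\to *_qX$ of families. A typing derivation of $\Gamma\vdash e:\tau$ denotes a morphism $[\![\Gamma]\!]\to[\![\tau]\!]$ defined by recursion on it in the standard way: $\mathsf{rec}$ uses the guarded fixpoint morphism $X^{*_{\underline{-1}}X}\to X$; $e\,\mathsf{by}\,p$ uses $*_p[\![e]\!]$ and the isomorphism $[\![*_p\Gamma]\!]\cong *_p[\![\Gamma]\!]$;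 coercions act by post- and precomposition; and the last rule acts by precomposition with the tuple of projections given by $\sigma$. **Corollary (Denotational Coherence).** Let $e_1,e_2$ be explicit terms refining the same implicit term $t$, with $\Gamma\vdash e_1:\tau$ and $\Gamma\vdash e_2:\tau$. Then $$[\![\Gamma\vdash e_1:\tau]\!]=[\![\Gamma\vdash e_2:\tau]\!]$$ as morphisms $[\![\Gamma]\!]\to[\![\tau]\!]$ in the topos of trees; that is, any derivation of $\Gamma\vdash e_1:\tau$ and any derivation of $\Gamma\vdash e_2:\tau$ denote the same morphism. (In particular, the denotation of a typing judgment does not depend on the derivation.) -/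

import Mathlib

open CategoryTheory Opposite

universe u v

namespace WarpCalculus

/-! ## Time warps -/

/-- A time warp is a cocontinuous (that is, supremum-preserving) self-map of `ω + 1`,
and `ω + 1 = {0, 1, 2, …, ω}` is `ℕ∞`.  The order on time warps is the pointwise one. -/
abbrev TimeWarp : Type := sSupHom ℕ∞ ℕ∞

namespace TimeWarp

/-- The identity time warp. -/
noncomputable def one : TimeWarp := sSupHom.id ℕ∞

/-- The product `p ∗ q` of time warps is the composite "`q` after `p`". -/
noncomputable def star (p q : TimeWarp) : TimeWarp := q.comp p

/-- The time warp `-1` (the later modality): `n ↦ n - 1`, with `0 ↦ 0` and `ω ↦ ω`. -/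
def later : TimeWarp where
  toFun n := n - 1
  map_sSup' s := by
    have gc : GaloisConnection (fun n : ℕ∞ => n - 1) (fun n : ℕ∞ => n + 1) :=
      fun a b => tsub_le_iff_right
    rw [gc.l_sSup, sSup_image]

/-- The time warp `ω` (the constant modality): `0 ↦ 0` and `n ↦ ω` for `n ≠ 0`. -/
def omega : TimeWarp where
  toFun n := if n = 0 then 0 else ⊤
  map_sSup' s := by
    have gc : GaloisConnection (fun n : ℕ∞ => if n = 0 then (0 : ℕ∞) else ⊤)
        (fun n : ℕ∞ => if n = ⊤ then ⊤ else 0) := by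
      intro a b
      by_cases ha : a = 0 <;> by_cases hb : b = ⊤ <;> simp [ha, hb]
    exact (gc.l_sSup).trans (sSup_image).symm

/-- The linear system of a time warp, between the positive steps `m + 1` and `n + 1`:
it relates them when `m + 1 ≤ p (n + 1)`. -/
def Lin (p : TimeWarp) (m n : ℕ) : Prop :=
  ((m + 1 : ℕ) : ℕ∞) ≤ p ((n + 1 : ℕ) : ℕ∞)

theorem Lin.mono_left {p : TimeWarp} {m m' n : ℕ} (h : p.Lin m' n) (hm : m ≤ m') :
    p.Lin m n :=
  le_trans (by exact_mod_cast Nat.succ_le_succ hm) h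

theorem Lin.mono_right {p : TimeWarp} {m n n' : ℕ} (h : p.Lin m n) (hn : n ≤ n') :
    p.Lin m n' :=
  le_trans h (OrderHomClass.mono p (by exact_mod_cast Nat.succ_le_succ hn))

theorem Lin.of_le {p q : TimeWarp} (hqp : q ≤ p) {m n : ℕ} (h : q.Lin m n) : p.Lin m n :=
  le_trans h (hqp _)

theorem lin_one {m n : ℕ} : one.Lin m n ↔ m ≤ n := by
  change ((m + 1 : ℕ) : ℕ∞) ≤ ((n + 1 : ℕ) : ℕ∞) ↔ _
  rw [Nat.cast_le]
  omega

theorem lin_later {m n : ℕ} : later.Lin m n ↔ m < n := by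
  change ((m + 1 : ℕ) : ℕ∞) ≤ ((n + 1 : ℕ) : ℕ∞) - 1 ↔ _
  have : ((n + 1 : ℕ) : ℕ∞) - 1 = (n : ℕ∞) := by
    rw [Nat.cast_add, Nat.cast_one]
    exact AddLECancellable.add_tsub_cancel_right (ENat.addLECancellable_of_ne_top (by simp))
  rw [this, Nat.cast_le]
  omega

theorem lin_omega (m n : ℕ) : omega.Lin m n := by
  change ((m + 1 : ℕ) : ℕ∞) ≤ if ((n + 1 : ℕ) : ℕ∞) = 0 then 0 else ⊤
  simp

theorem Lin.star_mk {p q : TimeWarp} {k m n : ℕ} (hm : p.Lin m n) (hk : q.Lin k m) :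
    (p.star q).Lin k n :=
  le_trans hk (OrderHomClass.mono q hm)

theorem Lin.star_exists {p q : TimeWarp} {k n : ℕ} (h : (p.star q).Lin k n) :
    ∃ m, p.Lin m n ∧ q.Lin k m := by
  have h' : ((k + 1 : ℕ) : ℕ∞) ≤ q (p ((n + 1 : ℕ) : ℕ∞)) := h
  unfold Lin
  generalize p ((n + 1 : ℕ) : ℕ∞) = a at h' ⊢
  induction a using ENat.recTopCoe with
  | top =>
    have htop : (⊤ : ℕ∞) = ⨆ i : ℕ, ((i + 1 : ℕ) : ℕ∞) := by
      symm
      rw [iSup_eq_top]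
      intro b hb
      induction b using ENat.recTopCoe with
      | top => exact absurd hb (lt_irrefl _)
      | coe b => exact ⟨b, by exact_mod_cast Nat.lt_succ_self b⟩
    rw [htop, map_iSup] at h'
    have hk : (k : ℕ∞) < ⨆ i : ℕ, q ((i + 1 : ℕ) : ℕ∞) :=
      lt_of_lt_of_le (by exact_mod_cast Nat.lt_succ_self k) h'
    obtain ⟨i, hi⟩ := lt_iSup_iff.1 hk
    refine ⟨i, le_top, ?_⟩
    have := Order.add_one_le_of_lt hi
    exact_mod_cast this
  | coe a =>
    cases a with
    | zero =>
      have h0 : q ((0 : ℕ) : ℕ∞) = 0 := map_bot q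
      rw [h0] at h'
      simp at h'
    | succ a => exact ⟨a, le_rfl, h'⟩

end TimeWarp

/-! ## The topos of trees

The time steps of a tree begin at `1`.  Since `{1, 2, 3, …}` and `{0, 1, 2, …}` are isomorphic
ordered sets, the topos of trees is the category of presheaves on the ordered set `ℕ`; the natural
number `n` stands for the step `n + 1`. -/

/-- The topos of trees. -/
abbrev Trees : Type (u + 1) := ℕᵒᵖ ⥤ Type u

namespace Trees

/-- The set of observations of `X` at the step `n + 1`. -/
abbrev At (X : Trees.{u}) (n : ℕ) : Type u := X.obj (op n)

/-- The restriction maps of a tree. -/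
def res (X : Trees.{u}) {m n : ℕ} (h : m ≤ n) (x : X.At n) : X.At m :=
  X.map (homOfLE h).op x

theorem res_refl (X : Trees.{u}) {n : ℕ} (h : n ≤ n) (x : X.At n) : X.res h x = x :=
  congrArg (fun f => (ConcreteCategory.hom f) x) (X.map_id (op n))

theorem res_res (X : Trees.{u}) {k m n : ℕ} (h : k ≤ m) (h' : m ≤ n) (x : X.At n) :
    X.res h (X.res h' x) = X.res (h.trans h') x :=
  (congrArg (fun f => (ConcreteCategory.hom f) x)
    (X.map_comp (homOfLE h').op (homOfLE h).op)).symm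

/-- The components of a morphism of trees. -/
def app {X Y : Trees.{u}} (f : X ⟶ Y) (n : ℕ) (x : X.At n) : Y.At n :=
  NatTrans.app f (op n) x

theorem app_res {X Y : Trees.{u}} (f : X ⟶ Y) {m n : ℕ} (h : m ≤ n) (x : X.At n) :
    app f m (X.res h x) = Y.res h (app f n x) :=
  NatTrans.naturality_apply f (homOfLE h).op x

/-- Build a tree from its sets of observations and its restriction maps. -/
def mk (obj : ℕ → Type u) (r : ∀ {m n : ℕ}, m ≤ n → obj n → obj m)
    (r_refl : ∀ (n : ℕ) (x : obj n), r (le_refl n) x = x)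
    (r_res : ∀ {k m n : ℕ} (h : k ≤ m) (h' : m ≤ n) (x : obj n), r h (r h' x) = r (h.trans h') x) :
    Trees.{u} where
  obj n := obj n.unop
  map f := TypeCat.ofHom (r (leOfHom f.unop))
  map_id n := by
    apply ConcreteCategory.hom_ext
    intro x
    exact r_refl _ x
  map_comp f g := by
    apply ConcreteCategory.hom_ext
    intro x
    exact (r_res (leOfHom g.unop) (leOfHom f.unop) x).symm

/-- Build a morphism of trees from its components. -/
def hom {X Y : Trees.{u}} (f : ∀ n, X.At n → Y.At n)
    (hf : ∀ {m n : ℕ} (h : m ≤ n) (x : X.At n), f m (X.res h x) = Y.res h (f n x)) : X ⟶ Y where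
  app n := TypeCat.ofHom (f n.unop)
  naturality m n g := by
    apply ConcreteCategory.hom_ext
    intro x
    exact hf (leOfHom g.unop) x

/-! ### Finite products, sums and exponentials -/

/-- The product of a family of trees. -/
def pi {ι : Type} (X : ι → Trees.{u}) : Trees.{u} :=
  mk (fun n => ∀ i, (X i).At n) (fun h x i => (X i).res h (x i))
    (fun _ x => funext fun i => (X i).res_refl _ (x i))
    (fun h h' x => funext fun i => (X i).res_res h h' (x i))

/-- The binary product of trees. -/
abbrev prod (X Y : Trees.{u}) : Trees.{u} := FunctorToTypes.prod X Y

/-- The binary sum of trees. -/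
abbrev sum (X Y : Trees.{u}) : Trees.{u} := FunctorToTypes.coprod X Y

/-- Pairing of morphisms. -/
def pair {Z X Y : Trees.{u}} (f : Z ⟶ X) (g : Z ⟶ Y) : Z ⟶ prod X Y :=
  FunctorToTypes.prod.lift f g

/-- The first projection. -/
def fst {X Y : Trees.{u}} : prod X Y ⟶ X := FunctorToTypes.prod.fst

/-- The second projection. -/
def snd {X Y : Trees.{u}} : prod X Y ⟶ Y := FunctorToTypes.prod.snd

/-- The first injection. -/
def inl {X Y : Trees.{u}} : X ⟶ sum X Y := FunctorToTypes.coprod.inl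

/-- The second injection. -/
def inr {X Y : Trees.{u}} : Y ⟶ sum X Y := FunctorToTypes.coprod.inr

/-- The functorial action of binary products. -/
def prodMap {X X' Y Y' : Trees.{u}} (f : X ⟶ X') (g : Y ⟶ Y') : prod X Y ⟶ prod X' Y' :=
  pair (fst ≫ f) (snd ≫ g)

/-- The functorial action of binary sums. -/
def sumMap {X X' Y Y' : Trees.{u}} (f : X ⟶ X') (g : Y ⟶ Y') : sum X Y ⟶ sum X' Y' :=
  FunctorToTypes.coprod.desc (f ≫ inl) (g ≫ inr)

/-- Case analysis in a context: products distribute over sums. -/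
def caseOf {Z X Y W : Trees.{u}} (s : Z ⟶ sum X Y) (f : prod Z X ⟶ W) (g : prod Z Y ⟶ W) :
    Z ⟶ W :=
  hom
    (fun n z => Sum.elim (fun x => app f n (z, x)) (fun y => app g n (z, y))
      (app s n z : X.At n ⊕ Y.At n))
    (by
      intro m n h z
      have hs := app_res s h z
      rw [hs]
      change Sum.elim _ _ (Sum.map (X.res h) (Y.res h) (app s n z : X.At n ⊕ Y.At n)) = _
      rcases (app s n z : X.At n ⊕ Y.At n) with x | y
      · exact app_res f h ((z, x) : Z.At n × X.At n)
      · exact app_res g h ((z, y) : Z.At n × Y.At n))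

/-- The exponential `Y ^ X`: by the Yoneda lemma, its observations at a step are the
morphisms from the product of `X` with the corresponding representable presheaf to `Y`. -/
def exp (X Y : Trees.{u}) : Trees.{u} :=
  mk
    (fun n => { f : ∀ m, m ≤ n → X.At m → Y.At m //
      ∀ (k m : ℕ) (h : k ≤ m) (h' : m ≤ n) (x : X.At m),
        Y.res h (f m h' x) = f k (h.trans h') (X.res h x) })
    (fun h f => ⟨fun m hm => f.1 m (hm.trans h), fun k m hk hm x => f.2 k m hk (hm.trans h) x⟩)
    (fun _ _ => rfl)
    (fun _ _ _ => rfl)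

/-- Currying. -/
def curry {Z X Y : Trees.{u}} (f : prod Z X ⟶ Y) : Z ⟶ exp X Y :=
  hom
    (fun n z => ⟨fun m h x => app f m (Z.res h z, x), by
      intro k m h h' x
      have := app_res f h ((Z.res h' z, x) : Z.At m × X.At m)
      refine this.symm.trans ?_
      change app f k (Z.res h (Z.res h' z), X.res h x) = _
      rw [res_res]⟩)
    (by
      intro m n h z
      apply Subtype.ext
      funext k hk x
      change app f k (Z.res hk (Z.res h z), x) = app f k (Z.res (hk.trans h) z, x)
      rw [res_res])

/-- Evaluation. -/
def eval {X Y : Trees.{u}} : prod (exp X Y) X ⟶ Y :=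
  hom (fun n fx => fx.1.1 n le_rfl fx.2)
    (by
      intro m n h fx
      exact (fx.1.2 m n h le_rfl fx.2).symm)

/-- The functorial action of exponentials. -/
def expMap {X X' Y Y' : Trees.{u}} (f : X' ⟶ X) (g : Y ⟶ Y') : exp X Y ⟶ exp X' Y' :=
  curry (prodMap (𝟙 _) f ≫ eval ≫ g)

/-! ### The warping functors -/

/-- The tree `∗_p X`, that is, `X` pulled along (the linear system of) `p`: an observation at
the step `n` is a compatible family of observations of `X` at the steps `1 ≤ m ≤ p n`. -/
def warpObj (p : TimeWarp) (X : Trees.{u}) : Trees.{u} :=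
  mk
    (fun n => { x : ∀ m, p.Lin m n → X.At m //
      ∀ (k m : ℕ) (h : k ≤ m) (hm : p.Lin m n), X.res h (x m hm) = x k (hm.mono_left h) })
    (fun h x => ⟨fun m hm => x.1 m (hm.mono_right h),
      fun k m hk hm => x.2 k m hk (hm.mono_right h)⟩)
    (fun _ _ => rfl)
    (fun _ _ _ => rfl)

/-- The functorial action of `∗_p`. -/
def warpMap (p : TimeWarp) {X Y : Trees.{u}} (f : X ⟶ Y) : warpObj p X ⟶ warpObj p Y :=
  hom
    (fun _ x => ⟨fun m hm => app f m (x.1 m hm), fun k m h hm => by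
      rw [← app_res, x.2 k m h hm]⟩)
    (fun _ _ => rfl)

/-- The isomorphism from `X` to `∗_id X`. -/
noncomputable def wrap (X : Trees.{u}) : X ⟶ warpObj TimeWarp.one X :=
  hom
    (fun _ x => ⟨fun _ hm => X.res (TimeWarp.lin_one.1 hm) x, fun _ _ _ _ => X.res_res _ _ x⟩)
    (by
      intro m n h x
      apply Subtype.ext
      funext k hk
      exact X.res_res _ _ x)

/-- The isomorphism from `∗_id X` to `X`. -/
noncomputable def unwrap (X : Trees.{u}) : warpObj TimeWarp.one X ⟶ X :=
  hom (fun n x => x.1 n (TimeWarp.lin_one.2 le_rfl))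
    (by
      intro m n h x
      exact (x.2 m n h _).symm)

/-- The isomorphism from `∗_p ∗_q X` to `∗_{p ∗ q} X`.  The observation at `k ≤ q (p n)` is read
off at any `m ≤ p n` such that `k ≤ q m`; by compatibility, all of them give the same result. -/
noncomputable def concat (p q : TimeWarp) (X : Trees.{u}) :
    warpObj p (warpObj q X) ⟶ warpObj (p.star q) X :=
  have key : ∀ {n : ℕ} (x : (warpObj p (warpObj q X)).At n) (k m m' : ℕ) (hm : p.Lin m n)
      (hm' : p.Lin m' n) (hk : q.Lin k m) (hk' : q.Lin k m'),
      (x.1 m hm).1 k hk = (x.1 m' hm').1 k hk' := by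
    intro n x k m m' hm hm' hk hk'
    rcases le_total m m' with h | h
    · rw [← x.2 m m' h hm']; rfl
    · rw [← x.2 m' m h hm]; rfl
  hom
    (fun _ x => ⟨fun k hk => (x.1 hk.star_exists.choose hk.star_exists.choose_spec.1).1 k
        hk.star_exists.choose_spec.2, by
      intro j k h hk
      rw [(x.1 _ _).2 j k h]
      exact key x _ _ _ _ _ _ _⟩)
    (by
      intro m n h x
      apply Subtype.ext
      funext k hk
      exact key x _ _ _ _ _ _ _)

/-- The isomorphism from `∗_{p ∗ q} X` to `∗_p ∗_q X`. -/
noncomputable def decat (p q : TimeWarp) (X : Trees.{u}) :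
    warpObj (p.star q) X ⟶ warpObj p (warpObj q X) :=
  hom
    (fun _ x => ⟨fun _ hm => ⟨fun k hk => x.1 k (hm.star_mk hk),
        fun j k h hk => x.2 j k h (hm.star_mk hk)⟩,
      fun _ _ _ _ => rfl⟩)
    (fun _ _ => rfl)

/-- The natural transformation from `∗_p` to `∗_q`, when `q ≤ p`. -/
def delay (p q : TimeWarp) (hqp : q ≤ p) (X : Trees.{u}) : warpObj p X ⟶ warpObj q X :=
  hom
    (fun _ x => ⟨fun m hm => x.1 m (hm.of_le hqp), fun k m h hm => x.2 k m h (hm.of_le hqp)⟩)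
    (fun _ _ => rfl)

/-- The constant tree on a set. -/
abbrev const (A : Type u) : Trees.{u} := (Functor.const ℕᵒᵖ).obj A

/-- The isomorphism from a constant tree `Δ A` to `∗_ω (Δ A)`. -/
def inflate (A : Type u) : const A ⟶ warpObj TimeWarp.omega (const A) :=
  hom (fun _ a => ⟨fun _ _ => a, fun _ _ _ _ => rfl⟩) (fun _ _ => rfl)

/-- The isomorphism from `∗_p (X × Y)` to `∗_p X × ∗_p Y`. -/
def dist (p : TimeWarp) (X Y : Trees.{u}) :
    warpObj p (prod X Y) ⟶ prod (warpObj p X) (warpObj p Y) :=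
  pair (warpMap p fst) (warpMap p snd)

/-- The isomorphism from `∗_p X × ∗_p Y` to `∗_p (X × Y)`. -/
def fact (p : TimeWarp) (X Y : Trees.{u}) :
    prod (warpObj p X) (warpObj p Y) ⟶ warpObj p (prod X Y) :=
  hom
    (fun _ xy => ⟨fun m hm => (xy.1.1 m hm, xy.2.1 m hm), fun k m h hm =>
      Prod.ext (xy.1.2 k m h hm) (xy.2.2 k m h hm)⟩)
    (fun _ _ => rfl)

/-- The comparison from a product of warped trees to the warped product. -/
def factPi (p : TimeWarp) {ι : Type} (X : ι → Trees.{u}) :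
    pi (fun i => warpObj p (X i)) ⟶ warpObj p (pi X) :=
  hom
    (fun _ x => ⟨fun m hm i => (x i).1 m hm, fun k m h hm => funext fun i => (x i).2 k m h hm⟩)
    (fun _ _ => rfl)

/-! ### Guarded fixpoints -/

/-- An observation of `X` at a step yields an observation of `∗_{-1} X` at the next step. -/
def next (X : Trees.{u}) {n : ℕ} (x : X.At n) : (warpObj TimeWarp.later X).At (n + 1) :=
  ⟨fun _ hm => X.res (Nat.lt_succ_iff.1 (TimeWarp.lin_later.1 hm)) x,
    fun _ _ _ _ => X.res_res _ _ x⟩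

/-- The unique observation of `∗_{-1} X` at the first step. -/
def start (X : Trees.{u}) : (warpObj TimeWarp.later X).At 0 :=
  ⟨fun m hm => absurd (TimeWarp.lin_later.1 hm) (Nat.not_lt_zero m),
    fun _ m _ hm => absurd (TimeWarp.lin_later.1 hm) (Nat.not_lt_zero m)⟩

/-- The components of the fixpoint combinator. -/
def fixAt (X : Trees.{u}) : ∀ n, (exp (warpObj TimeWarp.later X) X).At n → X.At n
  | 0, g => g.1 0 le_rfl (start X)
  | n + 1, g => g.1 (n + 1) le_rfl
      (next X (fixAt X n ((exp (warpObj TimeWarp.later X) X).res (Nat.le_succ n) g)))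

theorem fixAt_res_succ (X : Trees.{u}) :
    ∀ (n : ℕ) (g : (exp (warpObj TimeWarp.later X) X).At (n + 1)),
    fixAt X n ((exp (warpObj TimeWarp.later X) X).res (Nat.le_succ n) g)
      = X.res (Nat.le_succ n) (fixAt X (n + 1) g)
  | 0, g => by
    change g.1 0 _ (start X) = X.res _ (g.1 1 le_rfl _)
    rw [g.2 0 1 (Nat.le_succ 0) le_rfl]
    refine congrArg (g.1 0 _) ?_
    apply Subtype.ext
    funext m hm
    exact absurd (TimeWarp.lin_later.1 hm) (Nat.not_lt_zero m)
  | n + 1, g => by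
    change g.1 (n + 1) _ (next X _) = X.res _ (g.1 (n + 2) le_rfl (next X _))
    rw [g.2 (n + 1) (n + 2) (Nat.le_succ _) le_rfl]
    refine congrArg (g.1 (n + 1) _) ?_
    apply Subtype.ext
    funext m hm
    have hmn : m ≤ n := Nat.lt_succ_iff.1 (TimeWarp.lin_later.1 hm)
    change X.res hmn (fixAt X n _) = X.res (hmn.trans (Nat.le_succ n)) (fixAt X (n + 1) _)
    rw [fixAt_res_succ X n, res_res]

/-- The fixpoint combinator from `X ^ (∗_{-1} X)` to `X`. -/
def fix (X : Trees.{u}) : exp (warpObj TimeWarp.later X) X ⟶ X :=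
  hom (fixAt X)
    (by
      intro m n h
      induction n, h using Nat.le_induction with
      | base => intro g; rw [res_refl, res_refl]
      | succ n h ih =>
        intro g
        have h1 := ih ((exp (warpObj TimeWarp.later X) X).res (Nat.le_succ n) g)
        rw [res_res, fixAt_res_succ, res_res] at h1
        exact h1)

/-! ### Streams -/

/-- The tree of streams over `X`.  A stream prefix at the step `n` consists of `n` elements; the
element of index `i < n` has been available since the step `i + 1` and so belongs to
`X` at the step `n - i`.  As a set, this is the product of the sets of observations of `X` at the
steps `1, …, n`. -/
def str (X : Trees.{u}) : Trees.{u} :=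
  mk (fun n => ∀ i, i ≤ n → X.At (n - i))
    (fun h x i hi => X.res (Nat.sub_le_sub_right h i) (x i (hi.trans h)))
    (fun _ x => funext fun i => funext fun hi => X.res_refl _ (x i hi))
    (fun _ _ _ => funext fun _ => funext fun _ => X.res_res _ _ _)

/-- The functorial action of streams. -/
def strMap {X Y : Trees.{u}} (f : X ⟶ Y) : str X ⟶ str Y :=
  hom (fun n x i hi => app f (n - i) (x i hi))
    (fun _ _ => funext fun _ => funext fun _ => app_res f _ _)

/-- The first element of a stream. -/
def head (X : Trees.{u}) : str X ⟶ X :=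
  hom (fun _ x => x 0 (Nat.zero_le _)) (fun _ _ => rfl)

theorem tail_index {m n : ℕ} (h : m < n) (i : ℕ) : m - i ≤ n - (i + 1) := by omega

theorem tail_bound {m n i : ℕ} (h : m < n) (hi : i ≤ m) : i + 1 ≤ n := by omega

theorem cons_index (n i : ℕ) : n - (i + 1) ≤ n - 1 - i := by omega

theorem cons_bound {n i : ℕ} (hi : i + 1 ≤ n) : i ≤ n - 1 := by omega

theorem cons_lt {n i : ℕ} (hi : i + 1 ≤ n) : n - 1 < n := by omega

/-- The tail of a stream, which is available one step later. -/
def tail (X : Trees.{u}) : str X ⟶ warpObj TimeWarp.later (str X) :=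
  hom
    (fun _ x => ⟨fun _ hm i hi =>
        X.res (tail_index (TimeWarp.lin_later.1 hm) i)
          (x (i + 1) (tail_bound (TimeWarp.lin_later.1 hm) hi)),
      fun _ _ _ _ => funext fun _ => funext fun _ => X.res_res _ _ _⟩)
    (by
      intro m n h x
      apply Subtype.ext
      funext k hk i hi
      exact X.res_res _ _ _)

/-- Stream construction, from a first element and a tail available one step later. -/
def cons (X : Trees.{u}) : prod X (warpObj TimeWarp.later (str X)) ⟶ str X :=
  hom
    (fun n xs i => match i with
      | 0 => fun _ => xs.1
      | i + 1 => fun hi =>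
        X.res (cons_index n i)
          (xs.2.1 (n - 1) (TimeWarp.lin_later.2 (cons_lt hi)) i (cons_bound hi)))
    (by
      intro m n h xs
      funext i hi
      cases i with
      | zero => rfl
      | succ i =>
        have hi' : i + 1 ≤ m := hi
        have hm : TimeWarp.later.Lin (n - 1) n :=
          TimeWarp.lin_later.2 (cons_lt (hi'.trans h))
        have hc := congrFun (congrFun (xs.2.2 (m - 1) (n - 1) (Nat.sub_le_sub_right h 1) hm) i)
          (cons_bound hi')
        change X.res _ (xs.2.1 (m - 1) _ i _) = X.res _ (X.res _ (xs.2.1 (n - 1) _ i _))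
        rw [← hc, res_res]
        exact X.res_res _ _ _)

end Trees

/-! ## Types and contexts -/

/-- Types over a set `G` of ground types. -/
inductive Ty (G : Type v) : Type v
  | ground (ν : G) : Ty G
  | str (τ : Ty G) : Ty G
  | arr (τ₁ τ₂ : Ty G) : Ty G
  | prod (τ₁ τ₂ : Ty G) : Ty G
  | sum (τ₁ τ₂ : Ty G) : Ty G
  | warp (p : TimeWarp) (τ : Ty G) : Ty G

/-- Typing contexts with `n` bindings.  Terms are taken up to renaming of bound variables;
they are represented with de Bruijn indices, so that the variables of a context with `n` bindings
are the elements of `Fin n`, the last binding being that of the variable `0`. -/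
abbrev Ctx (G : Type v) (n : ℕ) : Type v := Fin n → Ty G

/-- The context `Γ, x : τ`. -/
abbrev Ctx.snoc {G : Type v} {n : ℕ} (Γ : Ctx G n) (τ : Ty G) : Ctx G (n + 1) :=
  Fin.cons (α := fun _ => Ty G) τ Γ

/-! ## Coercions -/

/-- Type coercions. -/
inductive Coercion : Type
  | id : Coercion
  | seq (α₁ α₂ : Coercion) : Coercion
  | str (α : Coercion) : Coercion
  | arr (α₁ α₂ : Coercion) : Coercion
  | prod (α₁ α₂ : Coercion) : Coercion
  | sum (α₁ α₂ : Coercion) : Coercion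
  | warp (p : TimeWarp) (α : Coercion) : Coercion
  | wrap : Coercion
  | unwrap : Coercion
  | concat (p q : TimeWarp) : Coercion
  | decat (p q : TimeWarp) : Coercion
  | inflate : Coercion
  | dist : Coercion
  | fact : Coercion
  | delay (p q : TimeWarp) : Coercion

/-- Derivations of the subtyping judgment `α : τ <: τ'`. -/
inductive Sub {G : Type v} : Coercion → Ty G → Ty G → Type v
  | id (τ : Ty G) : Sub .id τ τ
  | seq {α₁ α₂ : Coercion} {τ₁ τ₂ τ₃ : Ty G} :
      Sub α₁ τ₁ τ₂ → Sub α₂ τ₂ τ₃ → Sub (.seq α₁ α₂) τ₁ τ₃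
  | str {α : Coercion} {τ τ' : Ty G} : Sub α τ τ' → Sub (.str α) (.str τ) (.str τ')
  | arr {α₁ α₂ : Coercion} {τ₁ τ₂ τ₁' τ₂' : Ty G} :
      Sub α₁ τ₁' τ₁ → Sub α₂ τ₂ τ₂' → Sub (.arr α₁ α₂) (.arr τ₁ τ₂) (.arr τ₁' τ₂')
  | prod {α₁ α₂ : Coercion} {τ₁ τ₂ τ₁' τ₂' : Ty G} :
      Sub α₁ τ₁ τ₁' → Sub α₂ τ₂ τ₂' → Sub (.prod α₁ α₂) (.prod τ₁ τ₂) (.prod τ₁' τ₂')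
  | sum {α₁ α₂ : Coercion} {τ₁ τ₂ τ₁' τ₂' : Ty G} :
      Sub α₁ τ₁ τ₁' → Sub α₂ τ₂ τ₂' → Sub (.sum α₁ α₂) (.sum τ₁ τ₂) (.sum τ₁' τ₂')
  | warp (p : TimeWarp) {α : Coercion} {τ τ' : Ty G} :
      Sub α τ τ' → Sub (.warp p α) (.warp p τ) (.warp p τ')
  | wrap (τ : Ty G) : Sub .wrap τ (.warp TimeWarp.one τ)
  | unwrap (τ : Ty G) : Sub .unwrap (.warp TimeWarp.one τ) τ
  | concat (p q : TimeWarp) (τ : Ty G) :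
      Sub (.concat p q) (.warp p (.warp q τ)) (.warp (p.star q) τ)
  | decat (p q : TimeWarp) (τ : Ty G) :
      Sub (.decat p q) (.warp (p.star q) τ) (.warp p (.warp q τ))
  | inflate (ν : G) : Sub .inflate (.ground ν) (.warp TimeWarp.omega (.ground ν))
  | dist (p : TimeWarp) (τ₁ τ₂ : Ty G) :
      Sub .dist (.warp p (.prod τ₁ τ₂)) (.prod (.warp p τ₁) (.warp p τ₂))
  | fact (p : TimeWarp) (τ₁ τ₂ : Ty G) :
      Sub .fact (.prod (.warp p τ₁) (.warp p τ₂)) (.warp p (.prod τ₁ τ₂))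
  | delay (p q : TimeWarp) (hqp : q ≤ p) (τ : Ty G) : Sub (.delay p q) (.warp p τ) (.warp q τ)

/-! ## Terms -/

/-- Explicit terms with free variables among `n` variables.  The scalars of the ground type `ν`
are the elements of `S ν`; the disjointness of the sets of scalars is reflected in the syntax.
A context coercion is a finite partial map from variables to coercions. -/
inductive ETerm {G : Type v} (S : G → Type u) : ℕ → Type (max u v)
  | var {n : ℕ} (x : Fin n) : ETerm S n
  | lam {n : ℕ} (τ : Ty G) (e : ETerm S (n + 1)) : ETerm S n
  | app {n : ℕ} (e₁ e₂ : ETerm S n) : ETerm S n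
  | pair {n : ℕ} (e₁ e₂ : ETerm S n) : ETerm S n
  | proj₁ {n : ℕ} (e : ETerm S n) : ETerm S n
  | proj₂ {n : ℕ} (e : ETerm S n) : ETerm S n
  | inj₁ {n : ℕ} (τ₂ : Ty G) (e : ETerm S n) : ETerm S n
  | inj₂ {n : ℕ} (τ₁ : Ty G) (e : ETerm S n) : ETerm S n
  | case {n : ℕ} (e : ETerm S n) (e₁ e₂ : ETerm S (n + 1)) : ETerm S n
  | head {n : ℕ} (e : ETerm S n) : ETerm S n
  | tail {n : ℕ} (e : ETerm S n) : ETerm S n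
  | cons {n : ℕ} (e₁ e₂ : ETerm S n) : ETerm S n
  | scalar {n : ℕ} (ν : G) (s : S ν) : ETerm S n
  | recur {n : ℕ} (τ : Ty G) (e : ETerm S (n + 1)) : ETerm S n
  | by_ {n : ℕ} (e : ETerm S n) (p : TimeWarp) : ETerm S n
  | coeR {n : ℕ} (e : ETerm S n) (α : Coercion) : ETerm S n
  | coeL {n : ℕ} (β : Fin n → Option Coercion) (e : ETerm S n) : ETerm S n

/-- Implicit terms: terms without coercions. -/
inductive ITerm {G : Type v} (S : G → Type u) : ℕ → Type (max u v)
  | var {n : ℕ} (x : Fin n) : ITerm S n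
  | lam {n : ℕ} (τ : Ty G) (t : ITerm S (n + 1)) : ITerm S n
  | app {n : ℕ} (t₁ t₂ : ITerm S n) : ITerm S n
  | pair {n : ℕ} (t₁ t₂ : ITerm S n) : ITerm S n
  | proj₁ {n : ℕ} (t : ITerm S n) : ITerm S n
  | proj₂ {n : ℕ} (t : ITerm S n) : ITerm S n
  | inj₁ {n : ℕ} (τ₂ : Ty G) (t : ITerm S n) : ITerm S n
  | inj₂ {n : ℕ} (τ₁ : Ty G) (t : ITerm S n) : ITerm S n
  | case {n : ℕ} (t : ITerm S n) (t₁ t₂ : ITerm S (n + 1)) : ITerm S n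
  | head {n : ℕ} (t : ITerm S n) : ITerm S n
  | tail {n : ℕ} (t : ITerm S n) : ITerm S n
  | cons {n : ℕ} (t₁ t₂ : ITerm S n) : ITerm S n
  | scalar {n : ℕ} (ν : G) (s : S ν) : ITerm S n
  | recur {n : ℕ} (τ : Ty G) (t : ITerm S (n + 1)) : ITerm S n
  | by_ {n : ℕ} (t : ITerm S n) (p : TimeWarp) : ITerm S n

/-- Erasure of the coercions of an explicit term. -/
def ETerm.erase {G : Type v} {S : G → Type u} : ∀ {n : ℕ}, ETerm S n → ITerm S n
  | _, .var x => .var x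
  | _, .lam τ e => .lam τ e.erase
  | _, .app e₁ e₂ => .app e₁.erase e₂.erase
  | _, .pair e₁ e₂ => .pair e₁.erase e₂.erase
  | _, .proj₁ e => .proj₁ e.erase
  | _, .proj₂ e => .proj₂ e.erase
  | _, .inj₁ τ₂ e => .inj₁ τ₂ e.erase
  | _, .inj₂ τ₁ e => .inj₂ τ₁ e.erase
  | _, .case e e₁ e₂ => .case e.erase e₁.erase e₂.erase
  | _, .head e => .head e.erase
  | _, .tail e => .tail e.erase
  | _, .cons e₁ e₂ => .cons e₁.erase e₂.erase
  | _, .scalar ν s => .scalar ν s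
  | _, .recur τ e => .recur τ e.erase
  | _, .by_ e p => .by_ e.erase p
  | _, .coeR e _ => e.erase
  | _, .coeL _ e => e.erase

/-- The explicit term `e` refines the implicit term `t`. -/
def Refines {G : Type v} {S : G → Type u} {n : ℕ} (e : ETerm S n) (t : ITerm S n) : Prop :=
  e.erase = t

/-- The extension of a variable substitution to the scope of a binder. -/
def liftVar {n m : ℕ} (σ : Fin n → Fin m) : Fin (n + 1) → Fin (m + 1) :=
  Fin.cases 0 (fun x => (σ x).succ)

/-- `Rename σ e e'` says that `e' = σ[e]`, the result of applying the variable substitution `σ`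
to `e`.  A context coercion `β`, seen as a set of bindings `x ↦ α`, is sent to the set of bindings
`σ x ↦ α`; when that set is not a partial map (two variables coerced differently have been
identified), the result is not an explicit term, so that `σ[e]` does not exist. -/
inductive Rename {G : Type v} {S : G → Type u} :
    ∀ {n m : ℕ}, (Fin n → Fin m) → ETerm S n → ETerm S m → Prop
  | var {n m : ℕ} {σ : Fin n → Fin m} (x : Fin n) : Rename σ (.var x) (.var (σ x))
  | lam {n m : ℕ} {σ : Fin n → Fin m} (τ : Ty G) {e : ETerm S (n + 1)} {e' : ETerm S (m + 1)} :
      Rename (liftVar σ) e e' → Rename σ (.lam τ e) (.lam τ e')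
  | app {n m : ℕ} {σ : Fin n → Fin m} {e₁ e₂ : ETerm S n} {e₁' e₂' : ETerm S m} :
      Rename σ e₁ e₁' → Rename σ e₂ e₂' → Rename σ (.app e₁ e₂) (.app e₁' e₂')
  | pair {n m : ℕ} {σ : Fin n → Fin m} {e₁ e₂ : ETerm S n} {e₁' e₂' : ETerm S m} :
      Rename σ e₁ e₁' → Rename σ e₂ e₂' → Rename σ (.pair e₁ e₂) (.pair e₁' e₂')
  | proj₁ {n m : ℕ} {σ : Fin n → Fin m} {e : ETerm S n} {e' : ETerm S m} :
      Rename σ e e' → Rename σ (.proj₁ e) (.proj₁ e')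
  | proj₂ {n m : ℕ} {σ : Fin n → Fin m} {e : ETerm S n} {e' : ETerm S m} :
      Rename σ e e' → Rename σ (.proj₂ e) (.proj₂ e')
  | inj₁ {n m : ℕ} {σ : Fin n → Fin m} (τ₂ : Ty G) {e : ETerm S n} {e' : ETerm S m} :
      Rename σ e e' → Rename σ (.inj₁ τ₂ e) (.inj₁ τ₂ e')
  | inj₂ {n m : ℕ} {σ : Fin n → Fin m} (τ₁ : Ty G) {e : ETerm S n} {e' : ETerm S m} :
      Rename σ e e' → Rename σ (.inj₂ τ₁ e) (.inj₂ τ₁ e')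
  | case {n m : ℕ} {σ : Fin n → Fin m} {e : ETerm S n} {e' : ETerm S m}
      {e₁ e₂ : ETerm S (n + 1)} {e₁' e₂' : ETerm S (m + 1)} :
      Rename σ e e' → Rename (liftVar σ) e₁ e₁' → Rename (liftVar σ) e₂ e₂' →
      Rename σ (.case e e₁ e₂) (.case e' e₁' e₂')
  | head {n m : ℕ} {σ : Fin n → Fin m} {e : ETerm S n} {e' : ETerm S m} :
      Rename σ e e' → Rename σ (.head e) (.head e')
  | tail {n m : ℕ} {σ : Fin n → Fin m} {e : ETerm S n} {e' : ETerm S m} :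
      Rename σ e e' → Rename σ (.tail e) (.tail e')
  | cons {n m : ℕ} {σ : Fin n → Fin m} {e₁ e₂ : ETerm S n} {e₁' e₂' : ETerm S m} :
      Rename σ e₁ e₁' → Rename σ e₂ e₂' → Rename σ (.cons e₁ e₂) (.cons e₁' e₂')
  | scalar {n m : ℕ} {σ : Fin n → Fin m} (ν : G) (s : S ν) :
      Rename σ (.scalar ν s) (.scalar ν s)
  | recur {n m : ℕ} {σ : Fin n → Fin m} (τ : Ty G) {e : ETerm S (n + 1)} {e' : ETerm S (m + 1)} :
      Rename (liftVar σ) e e' → Rename σ (.recur τ e) (.recur τ e')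
  | by_ {n m : ℕ} {σ : Fin n → Fin m} {e : ETerm S n} {e' : ETerm S m} (p : TimeWarp) :
      Rename σ e e' → Rename σ (.by_ e p) (.by_ e' p)
  | coeR {n m : ℕ} {σ : Fin n → Fin m} {e : ETerm S n} {e' : ETerm S m} (α : Coercion) :
      Rename σ e e' → Rename σ (.coeR e α) (.coeR e' α)
  | coeL {n m : ℕ} {σ : Fin n → Fin m} {e : ETerm S n} {e' : ETerm S m}
      {β : Fin n → Option Coercion} {β' : Fin m → Option Coercion} :
      (∀ y α, β' y = some α ↔ ∃ x, σ x = y ∧ β x = some α) →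
      Rename σ e e' → Rename σ (.coeL β e) (.coeL β' e')

/-- Derivations of the typing judgment `Γ ⊢ e : τ` of explicit terms.  A structure map from `Γ` to
`Γ'` is a map `σ` of variables such that `Γ' (σ x) = Γ x` for all `x`, so that `Γ` is determined by
`Γ'` and `σ`. -/
inductive Typing {G : Type v} {S : G → Type u} :
    ∀ {n : ℕ}, Ctx G n → ETerm S n → Ty G → Type (max u v)
  | var {n : ℕ} (Γ : Ctx G n) (τ : Ty G) : Typing (Γ.snoc τ) (.var 0) τ
  | lam {n : ℕ} {Γ : Ctx G n} {τ₁ τ₂ : Ty G} {e : ETerm S (n + 1)} :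
      Typing (Γ.snoc τ₁) e τ₂ → Typing Γ (.lam τ₁ e) (.arr τ₁ τ₂)
  | app {n : ℕ} {Γ : Ctx G n} {τ₁ τ₂ : Ty G} {e₁ e₂ : ETerm S n} :
      Typing Γ e₁ (.arr τ₁ τ₂) → Typing Γ e₂ τ₁ → Typing Γ (.app e₁ e₂) τ₂
  | pair {n : ℕ} {Γ : Ctx G n} {τ₁ τ₂ : Ty G} {e₁ e₂ : ETerm S n} :
      Typing Γ e₁ τ₁ → Typing Γ e₂ τ₂ → Typing Γ (.pair e₁ e₂) (.prod τ₁ τ₂)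
  | proj₁ {n : ℕ} {Γ : Ctx G n} {τ₁ τ₂ : Ty G} {e : ETerm S n} :
      Typing Γ e (.prod τ₁ τ₂) → Typing Γ (.proj₁ e) τ₁
  | proj₂ {n : ℕ} {Γ : Ctx G n} {τ₁ τ₂ : Ty G} {e : ETerm S n} :
      Typing Γ e (.prod τ₁ τ₂) → Typing Γ (.proj₂ e) τ₂
  | inj₁ {n : ℕ} {Γ : Ctx G n} {τ₁ : Ty G} (τ₂ : Ty G) {e : ETerm S n} :
      Typing Γ e τ₁ → Typing Γ (.inj₁ τ₂ e) (.sum τ₁ τ₂)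
  | inj₂ {n : ℕ} {Γ : Ctx G n} (τ₁ : Ty G) {τ₂ : Ty G} {e : ETerm S n} :
      Typing Γ e τ₂ → Typing Γ (.inj₂ τ₁ e) (.sum τ₁ τ₂)
  | case {n : ℕ} {Γ : Ctx G n} {τ₁ τ₂ τ : Ty G} {e : ETerm S n} {e₁ e₂ : ETerm S (n + 1)} :
      Typing Γ e (.sum τ₁ τ₂) → Typing (Γ.snoc τ₁) e₁ τ → Typing (Γ.snoc τ₂) e₂ τ →
      Typing Γ (.case e e₁ e₂) τ
  | head {n : ℕ} {Γ : Ctx G n} {τ : Ty G} {e : ETerm S n} :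
      Typing Γ e (.str τ) → Typing Γ (.head e) τ
  | tail {n : ℕ} {Γ : Ctx G n} {τ : Ty G} {e : ETerm S n} :
      Typing Γ e (.str τ) → Typing Γ (.tail e) (.warp TimeWarp.later (.str τ))
  | cons {n : ℕ} {Γ : Ctx G n} {τ : Ty G} {e₁ e₂ : ETerm S n} :
      Typing Γ e₁ τ → Typing Γ e₂ (.warp TimeWarp.later (.str τ)) →
      Typing Γ (.cons e₁ e₂) (.str τ)
  | scalar {n : ℕ} (Γ : Ctx G n) (ν : G) (s : S ν) : Typing Γ (.scalar ν s) (.ground ν)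
  | recur {n : ℕ} {Γ : Ctx G n} {τ : Ty G} {e : ETerm S (n + 1)} :
      Typing (Γ.snoc (.warp TimeWarp.later τ)) e τ → Typing Γ (.recur τ e) τ
  | by_ {n : ℕ} {Γ : Ctx G n} {τ : Ty G} {e : ETerm S n} (p : TimeWarp) :
      Typing Γ e τ → Typing (fun x => .warp p (Γ x)) (.by_ e p) (.warp p τ)
  | coeR {n : ℕ} {Γ : Ctx G n} {τ τ' : Ty G} {e : ETerm S n} {α : Coercion} :
      Typing Γ e τ → Sub α τ τ' → Typing Γ (.coeR e α) τ'
  | coeL {n : ℕ} {Γ Γ' : Ctx G n} {τ : Ty G} {e : ETerm S n}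
      {β : Fin n → Option Coercion} (α : Fin n → Coercion) (hβ : ∀ x, β x = some (α x)) :
      (∀ x, Sub (α x) (Γ x) (Γ' x)) → Typing Γ' e τ → Typing Γ (.coeL β e) τ
  | struct {n m : ℕ} {Γ' : Ctx G m} {τ : Ty G} {e : ETerm S n} {e' : ETerm S m}
      (σ : Fin n → Fin m) (hσ : Rename σ e e') :
      Typing (fun x => Γ' (σ x)) e τ → Typing Γ' e' τ

/-! ## The interpretation -/

/-- The interpretation of types. -/
def Ty.sem {G : Type v} (S : G → Type u) : Ty G → Trees.{u}
  | .ground ν => Trees.const (S ν)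
  | .str τ => Trees.str (τ.sem S)
  | .arr τ₁ τ₂ => Trees.exp (τ₁.sem S) (τ₂.sem S)
  | .prod τ₁ τ₂ => Trees.prod (τ₁.sem S) (τ₂.sem S)
  | .sum τ₁ τ₂ => Trees.sum (τ₁.sem S) (τ₂.sem S)
  | .warp p τ => Trees.warpObj p (τ.sem S)

/-- The interpretation of contexts. -/
def Ctx.sem {G : Type v} (S : G → Type u) {n : ℕ} (Γ : Ctx G n) : Trees.{u} :=
  Trees.pi (fun x => (Γ x).sem S)

/-- The interpretation of subtyping derivations. -/
noncomputable def Sub.sem {G : Type v} (S : G → Type u) :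
    ∀ {α : Coercion} {τ τ' : Ty G}, Sub α τ τ' → (τ.sem S ⟶ τ'.sem S)
  | _, _, _, .id τ => 𝟙 (τ.sem S)
  | _, _, _, .seq c₁ c₂ => c₁.sem S ≫ c₂.sem S
  | _, _, _, .str c => Trees.strMap (c.sem S)
  | _, _, _, .arr c₁ c₂ => Trees.expMap (c₁.sem S) (c₂.sem S)
  | _, _, _, .prod c₁ c₂ => Trees.prodMap (c₁.sem S) (c₂.sem S)
  | _, _, _, .sum c₁ c₂ => Trees.sumMap (c₁.sem S) (c₂.sem S)
  | _, _, _, .warp p c => Trees.warpMap p (c.sem S)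
  | _, _, _, .wrap τ => Trees.wrap (τ.sem S)
  | _, _, _, .unwrap τ => Trees.unwrap (τ.sem S)
  | _, _, _, .concat p q τ => Trees.concat p q (τ.sem S)
  | _, _, _, .decat p q τ => Trees.decat p q (τ.sem S)
  | _, _, _, .inflate ν => Trees.inflate (S ν)
  | _, _, _, .dist p τ₁ τ₂ => Trees.dist p (τ₁.sem S) (τ₂.sem S)
  | _, _, _, .fact p τ₁ τ₂ => Trees.fact p (τ₁.sem S) (τ₂.sem S)
  | _, _, _, .delay p q hqp τ => Trees.delay p q hqp (τ.sem S)

/-- The canonical isomorphism from `⟦Γ⟧ × ⟦τ⟧` to `⟦Γ, x : τ⟧`. -/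
def Ctx.ext {G : Type v} (S : G → Type u) {n : ℕ} (Γ : Ctx G n) (τ : Ty G) :
    Trees.prod (Γ.sem S) (τ.sem S) ⟶ (Γ.snoc τ).sem S :=
  Trees.hom
    (fun k γx => fun y =>
      Fin.cases (motive := fun y => ((Γ.snoc τ y).sem S).At k) γx.2 (fun x => γx.1 x) y)
    (by
      intro k l h γx
      funext y
      cases y using Fin.cases <;> rfl)

/-- The projection from `⟦Γ⟧` to `⟦Γ x⟧`. -/
def Ctx.proj {G : Type v} (S : G → Type u) {n : ℕ} (Γ : Ctx G n) (x : Fin n) :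
    Γ.sem S ⟶ (Γ x).sem S :=
  Trees.hom (fun _ γ => γ x) (fun _ _ => rfl)

/-- The interpretation of a structure map, as a tuple of projections. -/
def Ctx.structMap {G : Type v} (S : G → Type u) {n m : ℕ} (Γ' : Ctx G m) (σ : Fin n → Fin m) :
    Γ'.sem S ⟶ Ctx.sem S (fun x => Γ' (σ x)) :=
  Trees.hom (fun _ γ => fun x => γ (σ x)) (fun _ _ => rfl)

/-- The interpretation of a context coercion, componentwise. -/
def Ctx.map {G : Type v} (S : G → Type u) {n : ℕ} {Γ Γ' : Ctx G n}
    (f : ∀ x, (Γ x).sem S ⟶ (Γ' x).sem S) : Γ.sem S ⟶ Γ'.sem S :=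
  Trees.hom (fun k γ => fun x => Trees.app (f x) k (γ x))
    (fun h γ => funext fun x => Trees.app_res (f x) h (γ x))

/-- The interpretation of typing derivations. -/
noncomputable def Typing.sem {G : Type v} {S : G → Type u} :
    ∀ {n : ℕ} {Γ : Ctx G n} {e : ETerm S n} {τ : Ty G},
      Typing Γ e τ → (Γ.sem S ⟶ τ.sem S)
  | _, _, _, _, .var Γ τ => Ctx.proj S (Γ.snoc τ) 0
  | _, _, _, _, .lam d => Trees.curry (Ctx.ext S _ _ ≫ d.sem)
  | _, _, _, _, .app d₁ d₂ => Trees.pair d₁.sem d₂.sem ≫ Trees.eval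
  | _, _, _, _, .pair d₁ d₂ => Trees.pair d₁.sem d₂.sem
  | _, _, _, _, .proj₁ d => d.sem ≫ Trees.fst
  | _, _, _, _, .proj₂ d => d.sem ≫ Trees.snd
  | _, _, _, _, .inj₁ _ d => d.sem ≫ Trees.inl
  | _, _, _, _, .inj₂ _ d => d.sem ≫ Trees.inr
  | _, _, _, _, .case d d₁ d₂ =>
      Trees.caseOf d.sem (Ctx.ext S _ _ ≫ d₁.sem) (Ctx.ext S _ _ ≫ d₂.sem)
  | _, _, _, _, .head d => d.sem ≫ Trees.head _
  | _, _, _, _, .tail d => d.sem ≫ Trees.tail _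
  | _, _, _, _, .cons d₁ d₂ => Trees.pair d₁.sem d₂.sem ≫ Trees.cons _
  | _, _, _, _, .scalar _ _ s => Trees.hom (fun _ _ => s) (fun _ _ => rfl)
  | _, _, _, _, .recur d => Trees.curry (Ctx.ext S _ _ ≫ d.sem) ≫ Trees.fix _
  | _, _, _, _, .by_ p d => Trees.factPi p _ ≫ Trees.warpMap p d.sem
  | _, _, _, _, .coeR d c => d.sem ≫ c.sem S
  | _, _, _, _, .coeL _ _ c d => Ctx.map S (fun x => (c x).sem S) ≫ d.sem
  | _, _, _, _, .struct σ _ d => Ctx.structMap S _ σ ≫ d.sem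

end WarpCalculus

namespace WarpCalculus

/-! Two derivations for terms with the same erasure may give a subterm different types in different
contexts, so their denotations there cannot be compared by an equation. They are compared by a
heterogeneous logical relation `Rel`, between an observation of τ at step k and an observation of σ
at step l, with no link required between τ and σ or between k and l. A warp on either side is peeled
off by requiring every member of the family to be related to the other side. Under equal type
formers the relation is the usual one, and under different ones it imposes nothing.

Three facts carry the proof. First, the relation ignores coercions (`Rel.coe_right`, with symmetry
`rel_comm`): each coercion only rearranges, restricts or duplicates members of families, and the
relation quantifies over all members. Second, on a single type it says exactly that the common
restrictions agree (`rel_self`), hence it is equality when the steps coincide. Third, it is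
preserved by every term former, so derivations whose terms have the same erasure send related
environments to related results (`sim`).

The relation is not transitive in general, because of the default clause, so coercions are not
removed by chaining equalities. Instead the two derivations are analysed together: rules for
coercions and structure maps, invisible to erasure, are absorbed on whichever side they occur, until
both derivations end with the rule for the same term former. The theorem is the case of one context,
one type and one environment. -/

/-- The member of index `m` of an observation of `∗_p τ`. -/
def Ty.warpAt {G : Type v} {S : G → Type u} {p : TimeWarp} {τ : Ty G} {n : ℕ}
    (x : ((Ty.warp p τ).sem S).At n) (m : ℕ) (h : p.Lin m n) : (τ.sem S).At m :=
  Subtype.val (p := fun _ : ∀ m, p.Lin m n → (τ.sem S).At m => _) x m h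

/-- The value at the step `m` of an observation of a function type. -/
def Ty.expAt {G : Type v} {S : G → Type u} {τ₁ τ₂ : Ty G} {n : ℕ}
    (f : ((Ty.arr τ₁ τ₂).sem S).At n) (m : ℕ) (h : m ≤ n) (x : (τ₁.sem S).At m) :
    (τ₂.sem S).At m :=
  Subtype.val (p := fun _ : ∀ m, m ≤ n → (τ₁.sem S).At m → (τ₂.sem S).At m => _) f m h x

open Trees Ty

/-! ### The logical relation across types and steps -/

/-- The heterogeneous relation saying that two observations, possibly of different types and at
different steps, agree as far as both of them are defined. -/
def Rel {G : Type v} (S : G → Type u) :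
    ∀ (τ σ : Ty G) {k l : ℕ}, (τ.sem S).At k → (σ.sem S).At l → Prop
  | .warp p τ, σ, k, _, s, t => ∀ m (h : p.Lin m k), Rel S τ σ (warpAt s m h) t
  | .ground ν, .warp q σ, _, l, s, t =>
      ∀ m (h : q.Lin m l), Rel S (.ground ν) σ s (warpAt t m h)
  | .str τ, .warp q σ, _, l, s, t =>
      ∀ m (h : q.Lin m l), Rel S (.str τ) σ s (warpAt t m h)
  | .arr τ₁ τ₂, .warp q σ, _, l, s, t =>
      ∀ m (h : q.Lin m l), Rel S (.arr τ₁ τ₂) σ s (warpAt t m h)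
  | .prod τ₁ τ₂, .warp q σ, _, l, s, t =>
      ∀ m (h : q.Lin m l), Rel S (.prod τ₁ τ₂) σ s (warpAt t m h)
  | .sum τ₁ τ₂, .warp q σ, _, l, s, t =>
      ∀ m (h : q.Lin m l), Rel S (.sum τ₁ τ₂) σ s (warpAt t m h)
  -- The two ground types may differ, so the values are compared by heterogeneous equality.
  | .ground _, .ground _, _, _, s, t => HEq s t
  | .str τ, .str σ, k, l, s, t =>
      ∀ i (hi : i ≤ k) (hi' : i ≤ l), Rel S τ σ (s i hi) (t i hi')
  | .arr τ₁ τ₂, .arr σ₁ σ₂, k, l, f, g =>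
      -- The steps k' and l' vary independently, and related arguments need not have the same type.
      ∀ k' (hk : k' ≤ k) l' (hl : l' ≤ l) (a : (τ₁.sem S).At k') (b : (σ₁.sem S).At l'),
        Rel S τ₁ σ₁ a b → Rel S τ₂ σ₂ (expAt f k' hk a) (expAt g l' hl b)
  | .prod τ₁ τ₂, .prod σ₁ σ₂, _, _, s, t =>
      Rel S τ₁ σ₁ (Prod.fst s) (Prod.fst t) ∧ Rel S τ₂ σ₂ (Prod.snd s) (Prod.snd t)
  | .sum τ₁ τ₂, .sum σ₁ σ₂, _, _, s, t =>
      Sum.elim (fun a => Sum.elim (fun b => Rel S τ₁ σ₁ a b) (fun _ => False) t)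
        (fun a => Sum.elim (fun _ => False) (fun b => Rel S τ₂ σ₂ a b) t) s
  -- The default must be `True` for `dist` to preserve the relation: an empty family of pairs is
  -- vacuously related to everything, and its image is a pair, compared for instance with a ground
  -- value.
  | _, _, _, _, _, _ => True
termination_by τ σ => sizeOf τ + sizeOf σ

variable {G : Type v} {S : G → Type u}

theorem rel_warp_left {p : TimeWarp} {τ σ : Ty G} {k l : ℕ} {s : ((Ty.warp p τ).sem S).At k}
    {t : (σ.sem S).At l} :
    Rel S (.warp p τ) σ s t ↔ ∀ m (h : p.Lin m k), Rel S τ σ (warpAt s m h) t := by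
  rw [Rel]

/-- The defining clauses peel warps on the left first. Peeling on the right is equally legitimate
because the two universal quantifications commute. -/
theorem rel_warp_right {q : TimeWarp} {τ σ : Ty G} {k l : ℕ} {s : (τ.sem S).At k}
    {t : ((Ty.warp q σ).sem S).At l} :
    Rel S τ (.warp q σ) s t ↔ ∀ m (h : q.Lin m l), Rel S τ σ s (warpAt t m h) := by
  induction τ generalizing k with
  | warp p τ ih =>
    simp only [rel_warp_left, ih]
    exact ⟨fun H m h m' h' => H m' h' m h, fun H m h m' h' => H m' h' m h⟩
  | _ => rw [Rel]

theorem rel_ground {ν : G} {k l : ℕ} {s : ((Ty.ground ν).sem S).At k}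
    {t : ((Ty.ground ν).sem S).At l} :
    Rel S (.ground ν) (.ground ν) s t ↔ (s : S ν) = (t : S ν) := by
  rw [Rel]; exact heq_iff_eq

theorem rel_str {τ σ : Ty G} {k l : ℕ} {s : ((Ty.str τ).sem S).At k}
    {t : ((Ty.str σ).sem S).At l} :
    Rel S (.str τ) (.str σ) s t ↔ ∀ i (hi : i ≤ k) (hi' : i ≤ l), Rel S τ σ (s i hi) (t i hi') := by
  rw [Rel]

theorem rel_arr {τ₁ τ₂ σ₁ σ₂ : Ty G} {k l : ℕ} {f : ((Ty.arr τ₁ τ₂).sem S).At k}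
    {g : ((Ty.arr σ₁ σ₂).sem S).At l} :
    Rel S (.arr τ₁ τ₂) (.arr σ₁ σ₂) f g ↔
      ∀ k' (hk : k' ≤ k) l' (hl : l' ≤ l) (a : (τ₁.sem S).At k') (b : (σ₁.sem S).At l'),
        Rel S τ₁ σ₁ a b → Rel S τ₂ σ₂ (expAt f k' hk a) (expAt g l' hl b) := by
  rw [Rel]

theorem rel_prod {τ₁ τ₂ σ₁ σ₂ : Ty G} {k l : ℕ} {s : ((Ty.prod τ₁ τ₂).sem S).At k}
    {t : ((Ty.prod σ₁ σ₂).sem S).At l} :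
    Rel S (.prod τ₁ τ₂) (.prod σ₁ σ₂) s t ↔
      Rel S τ₁ σ₁ (Prod.fst s) (Prod.fst t) ∧ Rel S τ₂ σ₂ (Prod.snd s) (Prod.snd t) := by
  rw [Rel]

theorem rel_sum {τ₁ τ₂ σ₁ σ₂ : Ty G} {k l : ℕ} {s : ((Ty.sum τ₁ τ₂).sem S).At k}
    {t : ((Ty.sum σ₁ σ₂).sem S).At l} :
    Rel S (.sum τ₁ τ₂) (.sum σ₁ σ₂) s t ↔
      Sum.elim (fun a => Sum.elim (fun b => Rel S τ₁ σ₁ a b) (fun _ => False) t)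
        (fun a => Sum.elim (fun _ => False) (fun b => Rel S τ₂ σ₂ a b) t) s := by
  rw [Rel]

/-! ### Symmetry and stability under restriction -/

theorem rel_comm {τ σ : Ty G} {k l : ℕ} {s : (τ.sem S).At k} {t : (σ.sem S).At l} :
    Rel S τ σ s t ↔ Rel S σ τ t s := by
  induction τ generalizing σ k l with
  | warp p τ ih => simp only [rel_warp_left, rel_warp_right, ih]
  | ground ν =>
    induction σ generalizing l with
    | warp q σ ih' => simp only [rel_warp_left, rel_warp_right, ih']
    | ground ν' => rw [Rel, Rel]; exact ⟨HEq.symm, HEq.symm⟩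
    | _ => simp [Rel]
  | str τ ih =>
    induction σ generalizing l with
    | warp q σ ih' => simp only [rel_warp_left, rel_warp_right, ih']
    | str σ _ =>
      simp only [rel_str, ih]
      exact ⟨fun H i hi hi' => H i hi' hi, fun H i hi hi' => H i hi' hi⟩
    | _ => simp [Rel]
  | arr τ₁ τ₂ ih₁ ih₂ =>
    induction σ generalizing l with
    | warp q σ ih' => simp only [rel_warp_left, rel_warp_right, ih']
    | arr σ₁ σ₂ _ _ =>
      simp only [rel_arr, ih₁, ih₂]
      exact ⟨fun H k hk l hl a b => H l hl k hk b a, fun H k hk l hl a b => H l hl k hk b a⟩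
    | _ => simp [Rel]
  | prod τ₁ τ₂ ih₁ ih₂ =>
    induction σ generalizing l with
    | warp q σ ih' => simp only [rel_warp_left, rel_warp_right, ih']
    | prod σ₁ σ₂ _ _ => simp only [rel_prod, ih₁, ih₂]
    | _ => simp [Rel]
  | sum τ₁ τ₂ ih₁ ih₂ =>
    induction σ generalizing l with
    | warp q σ ih' => simp only [rel_warp_left, rel_warp_right, ih']
    | sum σ₁ σ₂ _ _ =>
      rw [rel_sum, rel_sum]
      rcases s with a | a <;> rcases t with b | b
      · exact ih₁
      · exact Iff.rfl
      · exact Iff.rfl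
      · exact ih₂
    | _ => simp [Rel]

/-- Restricting only shrinks the sets of members, indices or steps over which the relation
quantifies; at sums and products this passes to the components. The inner inductions peel the warps
on the left until the two type formers can be compared. -/
theorem Rel.res_right {τ σ : Ty G} {k l l' : ℕ} (h : l' ≤ l) {s : (τ.sem S).At k}
    {t : (σ.sem S).At l} (H : Rel S τ σ s t) : Rel S τ σ s ((σ.sem S).res h t) := by
  induction σ generalizing τ k l l' with
  | warp q σ ih =>
    rw [rel_warp_right] at H ⊢
    exact fun m hm => H m (hm.mono_right h)
  | ground ν =>
    induction τ generalizing k with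
    | warp p τ ih' => exact rel_warp_left.2 fun m hm => ih' (rel_warp_left.1 H m hm)
    | ground ν' => rw [Rel] at H ⊢; exact H
    | _ => simp [Rel]
  | str σ ih =>
    induction τ generalizing k with
    | warp p τ ih' => exact rel_warp_left.2 fun m hm => ih' (rel_warp_left.1 H m hm)
    | str τ _ => exact rel_str.2 fun i hi hi' => ih _ (rel_str.1 H i hi (hi'.trans h))
    | _ => simp [Rel]
  | arr σ₁ σ₂ ih₁ ih₂ =>
    induction τ generalizing k with
    | warp p τ ih' => exact rel_warp_left.2 fun m hm => ih' (rel_warp_left.1 H m hm)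
    | arr τ₁ τ₂ _ _ =>
      exact rel_arr.2 fun k' hk l' hl a b => rel_arr.1 H k' hk l' (hl.trans h) a b
    | _ => simp [Rel]
  | prod σ₁ σ₂ ih₁ ih₂ =>
    induction τ generalizing k with
    | warp p τ ih' => exact rel_warp_left.2 fun m hm => ih' (rel_warp_left.1 H m hm)
    | prod τ₁ τ₂ _ _ =>
      exact rel_prod.2 ⟨ih₁ h (rel_prod.1 H).1, ih₂ h (rel_prod.1 H).2⟩
    | _ => simp [Rel]
  | sum σ₁ σ₂ ih₁ ih₂ =>
    induction τ generalizing k with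
    | warp p τ ih' => exact rel_warp_left.2 fun m hm => ih' (rel_warp_left.1 H m hm)
    | sum τ₁ τ₂ _ _ =>
      rw [rel_sum] at H ⊢
      rcases s with a | a <;> rcases t with b | b
      · exact ih₁ h H
      · exact H
      · exact H
      · exact ih₂ h H
    | _ => simp [Rel]

theorem Rel.res {τ σ : Ty G} {k k' l l' : ℕ} (hk : k' ≤ k) (hl : l' ≤ l) {s : (τ.sem S).At k}
    {t : (σ.sem S).At l} (H : Rel S τ σ s t) :
    Rel S τ σ ((τ.sem S).res hk s) ((σ.sem S).res hl t) :=
  rel_comm.1 (rel_comm.1 (H.res_right hl) |>.res_right hk)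

/-- At a single type, related observations are those with equal common restrictions. -/
theorem rel_self {τ : Ty G} {k l : ℕ} {s : (τ.sem S).At k} {t : (τ.sem S).At l} :
    Rel S τ τ s t ↔
      ∀ j (hk : j ≤ k) (hl : j ≤ l), (τ.sem S).res hk s = (τ.sem S).res hl t := by
  induction τ generalizing k l with
  | ground ν => exact rel_ground.trans ⟨fun h _ _ _ => h, fun H => H 0 (Nat.zero_le _) (Nat.zero_le _)⟩
  | warp p τ ih =>
    rw [rel_warp_left]
    simp only [rel_warp_right, ih]
    constructor
    · intro H j hk hl
      refine Subtype.ext (funext fun m => funext fun hm => ?_)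
      have := H m (hm.mono_right hk) m (hm.mono_right hl) m le_rfl le_rfl
      rwa [res_refl, res_refl] at this
    · intro H m hm m' hm' j hj hj'
      refine (s.2 j m hj hm).trans (Eq.trans ?_ (t.2 j m' hj' hm').symm)
      -- The families are compared at the smaller of the two outer steps, where one of them is not
      -- restricted at all; j belongs to its domain because a larger index does.
      rcases le_total k l with h | h
      · exact congrFun (congrFun (congrArg Subtype.val (H k le_rfl h)) j) (hm.mono_left hj)
      · exact congrFun (congrFun (congrArg Subtype.val (H l h le_rfl)) j) (hm'.mono_left hj')
  | str τ ih =>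
    simp only [rel_str, ih]
    constructor
    · intro H j hk hl
      exact funext fun i => funext fun hi => H i _ _ _ _ _
    · intro H i hi hi' j hj hj'
      -- The element of index i of a prefix at step j + i lives at j + i - i, equal to j but not
      -- definitionally so. Restricting along this inequality avoids a transport.
      have hji : j ≤ j + i - i := by omega
      have := congrArg ((τ.sem S).res hji)
        (congrFun (congrFun (H (j + i) (by omega) (by omega)) i) (Nat.le_add_left i j))
      exact (((τ.sem S).res_res _ _ _).symm.trans this).trans ((τ.sem S).res_res _ _ _)
  | arr τ₁ τ₂ ih₁ ih₂ =>
    simp only [rel_arr, ih₁, ih₂]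
    constructor
    · intro H j hk hl
      refine Subtype.ext (funext fun m => funext fun hm => funext fun a => ?_)
      -- The argument is related to itself by the induction hypothesis, so it can be fed to both
      -- functions.
      have := H m (hm.trans hk) m (hm.trans hl) a a (fun _ _ _ => rfl) m le_rfl le_rfl
      rwa [res_refl, res_refl] at this
    · intro H k' hk l' hl a b hab j hj hj'
      -- Naturality moves the restriction from the results to the arguments, whose restrictions
      -- agree by `hab`.
      refine (s.2 j k' hj hk a).trans (Eq.trans ?_ (t.2 j l' hj' hl b).symm)
      rw [hab j hj hj']
      exact congrFun (congrFun (congrFun (congrArg Subtype.val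
        (H j (hj.trans hk) (hj'.trans hl))) j) le_rfl) _
  | prod τ₁ τ₂ ih₁ ih₂ =>
    simp only [rel_prod, ih₁, ih₂]
    constructor
    · intro H j hk hl
      exact Prod.ext (H.1 j hk hl) (H.2 j hk hl)
    · intro H
      exact ⟨fun j hk hl => congrArg Prod.fst (H j hk hl),
        fun j hk hl => congrArg Prod.snd (H j hk hl)⟩
  | sum τ₁ τ₂ ih₁ ih₂ =>
    rw [rel_sum]
    rcases s with a | a <;> rcases t with b | b
    · exact ih₁.trans ⟨fun H j hk hl => congrArg Sum.inl (H j hk hl),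
        fun H j hk hl => Sum.inl.inj (H j hk hl)⟩
    -- Step 0 lies below both steps, and restriction preserves the side of a sum.
    · exact ⟨False.elim, fun H => Sum.inl_ne_inr (H 0 (Nat.zero_le _) (Nat.zero_le _))⟩
    · exact ⟨False.elim, fun H => Sum.inr_ne_inl (H 0 (Nat.zero_le _) (Nat.zero_le _))⟩
    · exact ih₂.trans ⟨fun H j hk hl => congrArg Sum.inr (H j hk hl),
        fun H j hk hl => Sum.inr.inj (H j hk hl)⟩

/-! ### Invariance under coercions -/

/-- Ground types denote constant presheaves, so only the value of an observation matters and not its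
step. This is what `inflate` needs. -/
theorem Rel.ground_right {τ : Ty G} {ν : G} {k l l' : ℕ} {s : (τ.sem S).At k}
    {x : ((Ty.ground ν).sem S).At l} {y : ((Ty.ground ν).sem S).At l'}
    (H : Rel S τ (.ground ν) s x) (h : (x : S ν) = (y : S ν)) : Rel S τ (.ground ν) s y := by
  induction τ generalizing k with
  | warp p τ ih => exact rel_warp_left.2 fun m hm => ih (rel_warp_left.1 H m hm)
  | ground ν' => rw [Rel] at H ⊢; exact H.trans (heq_of_eq h)
  | _ => simp [Rel]

/-- Quantifying over members commutes with the conjunction of the two components. As an equivalence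
it serves both `dist` and its inverse `fact`. -/
theorem rel_dist {p : TimeWarp} {τ σ₁ σ₂ : Ty G} {k l : ℕ} {s : (τ.sem S).At k}
    {t : ((Ty.warp p (.prod σ₁ σ₂)).sem S).At l} :
    Rel S τ (.warp p (.prod σ₁ σ₂)) s t ↔
      Rel S τ (.prod (.warp p σ₁) (.warp p σ₂)) s (app (dist p (σ₁.sem S) (σ₂.sem S)) l t) := by
  induction τ generalizing k with
  | warp p' τ ih =>
    exact rel_warp_left.trans ((forall₂_congr fun m hm => ih).trans rel_warp_left.symm)
  | prod τ₁ τ₂ _ _ =>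
    refine rel_warp_right.trans ⟨fun H => rel_prod.2 ⟨rel_warp_right.2 fun m h => ?_,
      rel_warp_right.2 fun m h => ?_⟩, fun H m h => rel_prod.2 ⟨?_, ?_⟩⟩
    · exact (rel_prod.1 (H m h)).1
    · exact (rel_prod.1 (H m h)).2
    · exact rel_warp_right.1 (rel_prod.1 H).1 m h
    · exact rel_warp_right.1 (rel_prod.1 H).2 m h
  | _ =>
    -- Against a type that is neither a warp nor a product, both sides reduce to the default clause.
    refine iff_of_true (rel_warp_right.2 fun m h => by simp [Rel]) ?_
    refine (?_ : ∀ t', Rel S _ _ _ t') _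
    simp [Rel]

/-- Coercions do not change what an observation is related to. -/
theorem Rel.coe_right {α : Coercion} {σ σ' : Ty G} (c : Sub α σ σ') {τ : Ty G} {k l : ℕ}
    {s : (τ.sem S).At k} {t : (σ.sem S).At l} (H : Rel S τ σ s t) :
    Rel S τ σ' s (app (c.sem S) l t) := by
  induction c generalizing τ k l with
  | id τ => exact H
  | seq c₁ c₂ ih₁ ih₂ => exact ih₂ (ih₁ H)
  | str c ih =>
    induction τ generalizing k with
    | warp p τ ih' => exact rel_warp_left.2 fun m hm => ih' (rel_warp_left.1 H m hm)
    | str τ _ => exact rel_str.2 fun i hi hi' => ih (rel_str.1 H i hi hi')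
    | _ => refine (?_ : ∀ t', Rel S _ _ _ t') _; simp [Rel]
  | arr c₁ c₂ ih₁ ih₂ =>
    induction τ generalizing k with
    | warp p τ ih' => exact rel_warp_left.2 fun m hm => ih' (rel_warp_left.1 H m hm)
    | arr τ₁ τ₂ _ _ =>
      -- By contravariance, the argument b crosses the first coercion before the function is
      -- applied, and the result then crosses the second.
      exact rel_arr.2 fun k' hk l' hl a b hab => ih₂ (rel_arr.1 H k' hk l' hl a _ (ih₁ hab))
    | _ => refine (?_ : ∀ t', Rel S _ _ _ t') _; simp [Rel]
  | prod c₁ c₂ ih₁ ih₂ =>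
    induction τ generalizing k with
    | warp p τ ih' => exact rel_warp_left.2 fun m hm => ih' (rel_warp_left.1 H m hm)
    | prod τ₁ τ₂ _ _ => exact rel_prod.2 ⟨ih₁ (rel_prod.1 H).1, ih₂ (rel_prod.1 H).2⟩
    | _ => refine (?_ : ∀ t', Rel S _ _ _ t') _; simp [Rel]
  | sum c₁ c₂ ih₁ ih₂ =>
    induction τ generalizing k with
    | warp p τ ih' => exact rel_warp_left.2 fun m hm => ih' (rel_warp_left.1 H m hm)
    | sum τ₁ τ₂ _ _ =>
      refine rel_sum.2 ?_
      rw [rel_sum] at H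
      rcases s with a | a <;> rcases t with b | b
      · exact ih₁ H
      · exact H
      · exact H
      · exact ih₂ H
    | _ => refine (?_ : ∀ t', Rel S _ _ _ t') _; simp [Rel]
  | warp p c ih => exact rel_warp_right.2 fun m hm => ih (rel_warp_right.1 H m hm)
  | wrap σ => exact rel_warp_right.2 fun m hm => H.res_right _
  | unwrap σ => exact rel_warp_right.1 H _ _
  | concat p q σ =>
    simp only [rel_warp_right] at H ⊢
    -- The hypothesis covers every intermediate index, in particular the one chosen by `concat`.
    exact fun m hm => H _ hm.star_exists.choose_spec.1 _ hm.star_exists.choose_spec.2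
  | decat p q σ =>
    simp only [rel_warp_right] at H ⊢
    exact fun m hm m' hm' => H m' (hm.star_mk hm')
  | inflate ν => exact rel_warp_right.2 fun m hm => H.ground_right rfl
  | dist p σ₁ σ₂ => exact rel_dist.1 H
  | fact p σ₁ σ₂ => exact rel_dist.2 H
  | delay p q hqp σ => exact rel_warp_right.2 fun m hm => rel_warp_right.1 H m (hm.of_le hqp)

/-! ## Renaming of implicit terms -/

theorem liftVar_comp {n m k : ℕ} (σ : Fin m → Fin k) (ρ : Fin n → Fin m) :
    liftVar (σ ∘ ρ) = liftVar σ ∘ liftVar ρ := by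
  funext x; cases x using Fin.cases <;> rfl

/-- The renaming of the free variables of an implicit term. -/
def ITerm.rename : ∀ {n m : ℕ}, (Fin n → Fin m) → ITerm S n → ITerm S m
  | _, _, σ, .var x => .var (σ x)
  | _, _, σ, .lam τ t => .lam τ (t.rename (liftVar σ))
  | _, _, σ, .app t₁ t₂ => .app (t₁.rename σ) (t₂.rename σ)
  | _, _, σ, .pair t₁ t₂ => .pair (t₁.rename σ) (t₂.rename σ)
  | _, _, σ, .proj₁ t => .proj₁ (t.rename σ)
  | _, _, σ, .proj₂ t => .proj₂ (t.rename σ)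
  | _, _, σ, .inj₁ τ₂ t => .inj₁ τ₂ (t.rename σ)
  | _, _, σ, .inj₂ τ₁ t => .inj₂ τ₁ (t.rename σ)
  | _, _, σ, .case t t₁ t₂ =>
      .case (t.rename σ) (t₁.rename (liftVar σ)) (t₂.rename (liftVar σ))
  | _, _, σ, .head t => .head (t.rename σ)
  | _, _, σ, .tail t => .tail (t.rename σ)
  | _, _, σ, .cons t₁ t₂ => .cons (t₁.rename σ) (t₂.rename σ)
  | _, _, _, .scalar ν s => .scalar ν s
  | _, _, σ, .recur τ t => .recur τ (t.rename (liftVar σ))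
  | _, _, σ, .by_ t p => .by_ (t.rename σ) p

theorem ITerm.rename_rename {n m k : ℕ} (ρ : Fin n → Fin m) (σ : Fin m → Fin k)
    (t : ITerm S n) : (t.rename ρ).rename σ = t.rename (σ ∘ ρ) := by
  induction t generalizing m k <;> simp_all [ITerm.rename, liftVar_comp]

/-- Renaming explicit terms is only a partial operation, since context coercions can clash. Erasure
discards them, and on implicit terms renaming is total. -/
theorem Rename.erase_eq {n m : ℕ} {σ : Fin n → Fin m} {e : ETerm S n} {e' : ETerm S m}
    (h : Rename σ e e') : e'.erase = e.erase.rename σ := by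
  induction h <;> simp_all [ITerm.rename, ETerm.erase]

/-! ## Similarity of typing derivations -/

/-- Environments that agree on the variables identified by `σ₁` and `σ₂`. -/
def EnvRel {n₁ n₂ m : ℕ} (σ₁ : Fin n₁ → Fin m) (σ₂ : Fin n₂ → Fin m) (Γ₁ : Ctx G n₁)
    (Γ₂ : Ctx G n₂) {k l : ℕ} (γ₁ : (Γ₁.sem S).At k) (γ₂ : (Γ₂.sem S).At l) : Prop :=
  ∀ x y, σ₁ x = σ₂ y → Rel S (Γ₁ x) (Γ₂ y) (γ₁ x) (γ₂ y)

theorem EnvRel.symm {n₁ n₂ m : ℕ} {σ₁ : Fin n₁ → Fin m} {σ₂ : Fin n₂ → Fin m} {Γ₁ : Ctx G n₁}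
    {Γ₂ : Ctx G n₂} {k l : ℕ} {γ₁ : (Γ₁.sem S).At k} {γ₂ : (Γ₂.sem S).At l}
    (H : EnvRel σ₁ σ₂ Γ₁ Γ₂ γ₁ γ₂) : EnvRel σ₂ σ₁ Γ₂ Γ₁ γ₂ γ₁ :=
  fun x y h => rel_comm.1 (H y x h.symm)

/-- The new variable is identified only with the new variable. The lower steps k' and l' are needed
because a function in the exponential can be applied at any earlier step. -/
theorem EnvRel.ext {n₁ n₂ m : ℕ} {σ₁ : Fin n₁ → Fin m} {σ₂ : Fin n₂ → Fin m} {Γ₁ : Ctx G n₁}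
    {Γ₂ : Ctx G n₂} {k l k' l' : ℕ} {γ₁ : (Γ₁.sem S).At k} {γ₂ : (Γ₂.sem S).At l}
    (H : EnvRel σ₁ σ₂ Γ₁ Γ₂ γ₁ γ₂) (hk : k' ≤ k) (hl : l' ≤ l) {τ₁ τ₂ : Ty G}
    {a : (τ₁.sem S).At k'} {b : (τ₂.sem S).At l'} (h : Rel S τ₁ τ₂ a b) :
    EnvRel (liftVar σ₁) (liftVar σ₂) (Γ₁.snoc τ₁) (Γ₂.snoc τ₂)
      (app (Ctx.ext S Γ₁ τ₁) k' ((Γ₁.sem S).res hk γ₁, a))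
      (app (Ctx.ext S Γ₂ τ₂) l' ((Γ₂.sem S).res hl γ₂, b)) := by
  intro x y hxy
  cases x using Fin.cases with
  | zero =>
    cases y using Fin.cases with
    | zero => exact h
    | succ y => exact absurd hxy (Fin.succ_ne_zero _).symm
  | succ x =>
    cases y using Fin.cases with
    | zero => exact absurd hxy (Fin.succ_ne_zero _)
    | succ y => exact (H x y (Fin.succ_injective _ hxy)).res hk hl

/-- Derivations whose terms have the same erasure, up to renaming, have related denotations. -/
def Sim {n₁ n₂ : ℕ} {Γ₁ : Ctx G n₁} {Γ₂ : Ctx G n₂} {e₁ : ETerm S n₁} {e₂ : ETerm S n₂}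
    {τ₁ τ₂ : Ty G} (d₁ : Typing Γ₁ e₁ τ₁) (d₂ : Typing Γ₂ e₂ τ₂) : Prop :=
  ∀ (m : ℕ) (σ₁ : Fin n₁ → Fin m) (σ₂ : Fin n₂ → Fin m),
    e₁.erase.rename σ₁ = e₂.erase.rename σ₂ →
    ∀ (k l : ℕ) (γ₁ : (Γ₁.sem S).At k) (γ₂ : (Γ₂.sem S).At l), EnvRel σ₁ σ₂ Γ₁ Γ₂ γ₁ γ₂ →
      Rel S τ₁ τ₂ (app d₁.sem k γ₁) (app d₂.sem l γ₂)

/-! ### Absorbing the rules that erasure does not see -/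

section

variable {n₁ n₂ : ℕ} {Γ₁ : Ctx G n₁} {Γ₂ : Ctx G n₂} {e₁ : ETerm S n₁} {e₂ : ETerm S n₂}
    {τ₁ τ₂ : Ty G} {d₁ : Typing Γ₁ e₁ τ₁} {d₂ : Typing Γ₂ e₂ τ₂}

theorem Sim.symm (H : Sim d₁ d₂) : Sim d₂ d₁ :=
  fun m σ₂ σ₁ h k l γ₂ γ₁ hγ => rel_comm.1 (H m σ₁ σ₂ h.symm l k γ₁ γ₂ hγ.symm)

theorem Sim.coeR (H : Sim d₁ d₂) {τ' : Ty G} {α : Coercion} (c : Sub α τ₂ τ') :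
    Sim d₁ (d₂.coeR c) :=
  fun m σ₁ σ₂ h k l γ₁ γ₂ hγ => (H m σ₁ σ₂ h k l γ₁ γ₂ hγ).coe_right c

theorem Sim.coeL (H : Sim d₁ d₂) {Γ' : Ctx G n₂} {β : Fin n₂ → Option Coercion}
    (α : Fin n₂ → Coercion) (hβ : ∀ x, β x = some (α x)) (c : ∀ x, Sub (α x) (Γ' x) (Γ₂ x)) :
    Sim d₁ (.coeL α hβ c d₂) :=
  fun m σ₁ σ₂ h k l γ₁ _ hγ => H m σ₁ σ₂ h k l γ₁ _ fun x y hxy => (hγ x y hxy).coe_right (c y)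

/-- A structure map changes the variables of the term, which is why similarity quantifies over
renamings into a common set of variables: the map is composed into one of them. -/
theorem Sim.struct {Γ' : Ctx G n₂} {n : ℕ} (ρ : Fin n → Fin n₂) {e : ETerm S n}
    {d₂ : Typing (fun x => Γ' (ρ x)) e τ₂} (H : Sim d₁ d₂) (hρ : Rename ρ e e₂) :
    Sim d₁ (.struct ρ hρ d₂) := by
  intro m σ₁ σ₂ h k l γ₁ γ₂ hγ
  rw [hρ.erase_eq, ITerm.rename_rename] at h
  exact H m σ₁ (σ₂ ∘ ρ) h k l γ₁ _ fun x y hxy => hγ x (ρ y) hxy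

end

/-! ### Compatibility of the relation with the term formers -/

theorem EnvRel.ext_self {n₁ n₂ m : ℕ} {σ₁ : Fin n₁ → Fin m} {σ₂ : Fin n₂ → Fin m} {Γ₁ : Ctx G n₁}
    {Γ₂ : Ctx G n₂} {k l : ℕ} {γ₁ : (Γ₁.sem S).At k} {γ₂ : (Γ₂.sem S).At l}
    (H : EnvRel σ₁ σ₂ Γ₁ Γ₂ γ₁ γ₂) {τ₁ τ₂ : Ty G}
    {a : (τ₁.sem S).At k} {b : (τ₂.sem S).At l} (h : Rel S τ₁ τ₂ a b) :
    EnvRel (liftVar σ₁) (liftVar σ₂) (Γ₁.snoc τ₁) (Γ₂.snoc τ₂)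
      (app (Ctx.ext S Γ₁ τ₁) k (γ₁, a)) (app (Ctx.ext S Γ₂ τ₂) l (γ₂, b)) := by
  have := H.ext le_rfl le_rfl h
  rwa [res_refl, res_refl] at this

/-- Both fixpoints are taken at the same type, so relatedness means equality of common restrictions,
and naturality of `fix` suffices. No induction on steps is needed. -/
theorem rel_fix {τ : Ty G} {k l : ℕ} {f : ((Ty.arr (.warp TimeWarp.later τ) τ).sem S).At k}
    {g : ((Ty.arr (.warp TimeWarp.later τ) τ).sem S).At l}
    (H : Rel S (.arr (.warp TimeWarp.later τ) τ) (.arr (.warp TimeWarp.later τ) τ) f g) :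
    Rel S τ τ (app (fix (τ.sem S)) k f) (app (fix (τ.sem S)) l g) :=
  rel_self.2 fun j hk hl =>
    (app_res (fix (τ.sem S)) hk f).symm.trans
      ((congrArg (app (fix (τ.sem S)) j) (rel_self.1 H j hk hl)).trans
        (app_res (fix (τ.sem S)) hl g))

theorem rel_elim {τ₁ τ₂ σ₁ σ₂ τ σ : Ty G} {k l : ℕ} {s : ((Ty.sum τ₁ τ₂).sem S).At k}
    {t : ((Ty.sum σ₁ σ₂).sem S).At l} (H : Rel S (.sum τ₁ τ₂) (.sum σ₁ σ₂) s t)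
    {f : (τ₁.sem S).At k → (τ.sem S).At k} {g : (τ₂.sem S).At k → (τ.sem S).At k}
    {f' : (σ₁.sem S).At l → (σ.sem S).At l} {g' : (σ₂.sem S).At l → (σ.sem S).At l}
    (hf : ∀ a b, Rel S τ₁ σ₁ a b → Rel S τ σ (f a) (f' b))
    (hg : ∀ a b, Rel S τ₂ σ₂ a b → Rel S τ σ (g a) (g' b)) :
    Rel S τ σ (Sum.elim f g s) (Sum.elim f' g' t) := by
  rw [rel_sum] at H
  rcases s with a | a <;> rcases t with b | b
  · exact hf a b H
  · exact H.elim
  · exact H.elim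
  · exact hg a b H

theorem rel_tail {τ σ : Ty G} {k l : ℕ} {s : ((Ty.str τ).sem S).At k}
    {t : ((Ty.str σ).sem S).At l} (H : Rel S (.str τ) (.str σ) s t) :
    Rel S (.warp TimeWarp.later (.str τ)) (.warp TimeWarp.later (.str σ))
      (app (tail (τ.sem S)) k s) (app (tail (σ.sem S)) l t) :=
  rel_warp_left.2 fun _ _ => rel_warp_right.2 fun _ _ => rel_str.2 fun i _ _ =>
    (rel_str.1 H (i + 1) _ _).res _ _

/-- Past the head, the elements are read from the latest available members of the two delayed tails,
of indices k - 1 and l - 1. These may differ, but the relation covers all pairs of members. -/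
theorem rel_cons {τ σ : Ty G} {k l : ℕ} {a : (τ.sem S).At k} {b : (σ.sem S).At l}
    {s : ((Ty.warp TimeWarp.later (.str τ)).sem S).At k}
    {t : ((Ty.warp TimeWarp.later (.str σ)).sem S).At l} (h : Rel S τ σ a b)
    (H : Rel S (.warp TimeWarp.later (.str τ)) (.warp TimeWarp.later (.str σ)) s t) :
    Rel S (.str τ) (.str σ) (app (cons (τ.sem S)) k (a, s)) (app (cons (σ.sem S)) l (b, t)) :=
  rel_str.2 fun i hi hi' => by
    cases i with
    | zero => exact h
    | succ i =>
      exact (rel_str.1 (rel_warp_right.1 (rel_warp_left.1 H _ (TimeWarp.lin_later.2 (cons_lt hi)))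
        _ (TimeWarp.lin_later.2 (cons_lt hi'))) i (cons_bound hi) (cons_bound hi')).res _ _

/-- Related arguments extend the restricted environments to related ones, so similar bodies give
related functions. This serves both abstraction and recursion. -/
theorem rel_curry {n₁ n₂ m : ℕ} {Γ₁ : Ctx G n₁} {Γ₂ : Ctx G n₂} {e₁ : ETerm S (n₁ + 1)}
    {e₂ : ETerm S (n₂ + 1)} {τ₁ τ₂ σ₁ σ₂ : Ty G} {d₁ : Typing (Γ₁.snoc τ₁) e₁ τ₂}
    {d₂ : Typing (Γ₂.snoc σ₁) e₂ σ₂} (H : Sim d₁ d₂) {ρ₁ : Fin n₁ → Fin m} {ρ₂ : Fin n₂ → Fin m}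
    (h : e₁.erase.rename (liftVar ρ₁) = e₂.erase.rename (liftVar ρ₂)) {k l : ℕ}
    {γ₁ : (Γ₁.sem S).At k} {γ₂ : (Γ₂.sem S).At l} (hγ : EnvRel ρ₁ ρ₂ Γ₁ Γ₂ γ₁ γ₂) :
    Rel S (.arr τ₁ τ₂) (.arr σ₁ σ₂) (app (curry (Ctx.ext S Γ₁ τ₁ ≫ d₁.sem)) k γ₁)
      (app (curry (Ctx.ext S Γ₂ σ₁ ≫ d₂.sem)) l γ₂) :=
  rel_arr.2 fun _ hk _ hl _ _ hab => H _ _ _ h _ _ _ _ (hγ.ext hk hl hab)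

/-! ### The fundamental lemma -/

/-- Any two derivations are similar. -/
theorem sim {n₁ n₂ : ℕ} {Γ₁ : Ctx G n₁} {Γ₂ : Ctx G n₂} {e₁ : ETerm S n₁} {e₂ : ETerm S n₂}
    {τ₁ τ₂ : Ty G} (d₁ : Typing Γ₁ e₁ τ₁) (d₂ : Typing Γ₂ e₂ τ₂) : Sim d₁ d₂ := by
  induction d₁ generalizing n₂ Γ₂ e₂ τ₂ with
  -- The absorption lemmas act on the right; symmetry transfers them to the left derivation.
  | coeR d c ih => exact ((ih d₂).symm.coeR c).symm
  | coeL α hβ c d ih => exact ((ih d₂).symm.coeL α hβ c).symm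
  | struct ρ hρ d ih => exact ((ih d₂).symm.struct ρ hρ).symm
  | var Γ τ =>
    -- The inner induction strips the same three rules from the right derivation. After that, either
    -- both derivations end with the rule for the same term former, or their erasures have different
    -- heads.
    induction d₂ with
    | coeR d c ih => exact ih.coeR c
    | coeL α hβ c d ih => exact ih.coeL α hβ c
    | struct ρ hρ d ih => exact ih.struct ρ hρ
    -- The variable rule types only the last binding, so equality of the renamed terms is exactly
    -- the identification of the two variables 0.
    | var Γ' τ' => exact fun m σ₁ σ₂ h k l γ₁ γ₂ hγ => hγ 0 0 (ITerm.var.inj h)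
    | _ => intro m σ₁ σ₂ h; simp [ETerm.erase, ITerm.rename] at h
  | lam d₁ ih₁ =>
    induction d₂ with
    | coeR d c ih => exact ih.coeR c
    | coeL α hβ c d ih => exact ih.coeL α hβ c
    | struct ρ hρ d ih => exact ih.struct ρ hρ
    | lam d₂ _ =>
      intro m σ₁ σ₂ h k l γ₁ γ₂ hγ
      exact rel_curry (ih₁ d₂) (ITerm.lam.inj h).2 hγ
    | _ => intro m σ₁ σ₂ h; simp [ETerm.erase, ITerm.rename] at h
  | app d₁ d₁' ih₁ ih₁' =>
    induction d₂ with
    | coeR d c ih => exact ih.coeR c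
    | coeL α hβ c d ih => exact ih.coeL α hβ c
    | struct ρ hρ d ih => exact ih.struct ρ hρ
    | app d₂ d₂' _ _ =>
      intro m σ₁ σ₂ h k l γ₁ γ₂ hγ
      exact rel_arr.1 (ih₁ d₂ _ _ _ (ITerm.app.inj h).1 _ _ _ _ hγ) _ le_rfl _ le_rfl _ _
        (ih₁' d₂' _ _ _ (ITerm.app.inj h).2 _ _ _ _ hγ)
    | _ => intro m σ₁ σ₂ h; simp [ETerm.erase, ITerm.rename] at h
  | pair d₁ d₁' ih₁ ih₁' =>
    induction d₂ with
    | coeR d c ih => exact ih.coeR c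
    | coeL α hβ c d ih => exact ih.coeL α hβ c
    | struct ρ hρ d ih => exact ih.struct ρ hρ
    | pair d₂ d₂' _ _ =>
      intro m σ₁ σ₂ h k l γ₁ γ₂ hγ
      exact rel_prod.2 ⟨ih₁ d₂ _ _ _ (ITerm.pair.inj h).1 _ _ _ _ hγ,
        ih₁' d₂' _ _ _ (ITerm.pair.inj h).2 _ _ _ _ hγ⟩
    | _ => intro m σ₁ σ₂ h; simp [ETerm.erase, ITerm.rename] at h
  | proj₁ d₁ ih₁ =>
    induction d₂ with
    | coeR d c ih => exact ih.coeR c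
    | coeL α hβ c d ih => exact ih.coeL α hβ c
    | struct ρ hρ d ih => exact ih.struct ρ hρ
    | proj₁ d₂ _ =>
      intro m σ₁ σ₂ h k l γ₁ γ₂ hγ
      exact (rel_prod.1 (ih₁ d₂ _ _ _ (ITerm.proj₁.inj h) _ _ _ _ hγ)).1
    | _ => intro m σ₁ σ₂ h; simp [ETerm.erase, ITerm.rename] at h
  | proj₂ d₁ ih₁ =>
    induction d₂ with
    | coeR d c ih => exact ih.coeR c
    | coeL α hβ c d ih => exact ih.coeL α hβ c
    | struct ρ hρ d ih => exact ih.struct ρ hρ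
    | proj₂ d₂ _ =>
      intro m σ₁ σ₂ h k l γ₁ γ₂ hγ
      exact (rel_prod.1 (ih₁ d₂ _ _ _ (ITerm.proj₂.inj h) _ _ _ _ hγ)).2
    | _ => intro m σ₁ σ₂ h; simp [ETerm.erase, ITerm.rename] at h
  | inj₁ τ d₁ ih₁ =>
    induction d₂ with
    | coeR d c ih => exact ih.coeR c
    | coeL α hβ c d ih => exact ih.coeL α hβ c
    | struct ρ hρ d ih => exact ih.struct ρ hρ
    | inj₁ τ' d₂ _ =>
      intro m σ₁ σ₂ h k l γ₁ γ₂ hγ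
      exact rel_sum.2 (ih₁ d₂ _ _ _ (ITerm.inj₁.inj h).2 _ _ _ _ hγ)
    | _ => intro m σ₁ σ₂ h; simp [ETerm.erase, ITerm.rename] at h
  | inj₂ τ d₁ ih₁ =>
    induction d₂ with
    | coeR d c ih => exact ih.coeR c
    | coeL α hβ c d ih => exact ih.coeL α hβ c
    | struct ρ hρ d ih => exact ih.struct ρ hρ
    | inj₂ τ' d₂ _ =>
      intro m σ₁ σ₂ h k l γ₁ γ₂ hγ
      exact rel_sum.2 (ih₁ d₂ _ _ _ (ITerm.inj₂.inj h).2 _ _ _ _ hγ)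
    | _ => intro m σ₁ σ₂ h; simp [ETerm.erase, ITerm.rename] at h
  | case d₁ d₁' d₁'' ih₁ ih₁' ih₁'' =>
    induction d₂ with
    | coeR d c ih => exact ih.coeR c
    | coeL α hβ c d ih => exact ih.coeL α hβ c
    | struct ρ hρ d ih => exact ih.struct ρ hρ
    | case d₂ d₂' d₂'' _ _ _ =>
      intro m σ₁ σ₂ h k l γ₁ γ₂ hγ
      obtain ⟨h, h', h''⟩ := ITerm.case.inj h
      exact rel_elim (ih₁ d₂ _ _ _ h _ _ _ _ hγ)
        (fun _ _ hab => ih₁' d₂' _ _ _ h' _ _ _ _ (hγ.ext_self hab))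
        (fun _ _ hab => ih₁'' d₂'' _ _ _ h'' _ _ _ _ (hγ.ext_self hab))
    | _ => intro m σ₁ σ₂ h; simp [ETerm.erase, ITerm.rename] at h
  | head d₁ ih₁ =>
    induction d₂ with
    | coeR d c ih => exact ih.coeR c
    | coeL α hβ c d ih => exact ih.coeL α hβ c
    | struct ρ hρ d ih => exact ih.struct ρ hρ
    | head d₂ _ =>
      intro m σ₁ σ₂ h k l γ₁ γ₂ hγ
      exact rel_str.1 (ih₁ d₂ _ _ _ (ITerm.head.inj h) _ _ _ _ hγ) 0 _ _
    | _ => intro m σ₁ σ₂ h; simp [ETerm.erase, ITerm.rename] at h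
  | tail d₁ ih₁ =>
    induction d₂ with
    | coeR d c ih => exact ih.coeR c
    | coeL α hβ c d ih => exact ih.coeL α hβ c
    | struct ρ hρ d ih => exact ih.struct ρ hρ
    | tail d₂ _ =>
      intro m σ₁ σ₂ h k l γ₁ γ₂ hγ
      exact rel_tail (ih₁ d₂ _ _ _ (ITerm.tail.inj h) _ _ _ _ hγ)
    | _ => intro m σ₁ σ₂ h; simp [ETerm.erase, ITerm.rename] at h
  | cons d₁ d₁' ih₁ ih₁' =>
    induction d₂ with
    | coeR d c ih => exact ih.coeR c
    | coeL α hβ c d ih => exact ih.coeL α hβ c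
    | struct ρ hρ d ih => exact ih.struct ρ hρ
    | cons d₂ d₂' _ _ =>
      intro m σ₁ σ₂ h k l γ₁ γ₂ hγ
      exact rel_cons (ih₁ d₂ _ _ _ (ITerm.cons.inj h).1 _ _ _ _ hγ)
        (ih₁' d₂' _ _ _ (ITerm.cons.inj h).2 _ _ _ _ hγ)
    | _ => intro m σ₁ σ₂ h; simp [ETerm.erase, ITerm.rename] at h
  | scalar Γ ν s =>
    induction d₂ with
    | coeR d c ih => exact ih.coeR c
    | coeL α hβ c d ih => exact ih.coeL α hβ c
    | struct ρ hρ d ih => exact ih.struct ρ hρ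
    | scalar Γ' ν' s' =>
      intro m σ₁ σ₂ h k l γ₁ γ₂ hγ
      obtain ⟨rfl, h⟩ := ITerm.scalar.inj h
      exact rel_ground.2 (eq_of_heq h)
    | _ => intro m σ₁ σ₂ h; simp [ETerm.erase, ITerm.rename] at h
  | recur d₁ ih₁ =>
    induction d₂ with
    | coeR d c ih => exact ih.coeR c
    | coeL α hβ c d ih => exact ih.coeL α hβ c
    | struct ρ hρ d ih => exact ih.struct ρ hρ
    | recur d₂ _ =>
      intro m σ₁ σ₂ h k l γ₁ γ₂ hγ
      -- The annotation survives erasure, so both recursions are at the same type, as `rel_fix`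
      -- requires.
      obtain ⟨rfl, h'⟩ := ITerm.recur.inj h
      exact rel_fix (rel_curry (ih₁ d₂) h' hγ)
    | _ => intro m σ₁ σ₂ h; simp [ETerm.erase, ITerm.rename] at h
  | by_ p d₁ ih₁ =>
    induction d₂ with
    | coeR d c ih => exact ih.coeR c
    | coeL α hβ c d ih => exact ih.coeL α hβ c
    | struct ρ hρ d ih => exact ih.struct ρ hρ
    | by_ q d₂ _ =>
      intro m σ₁ σ₂ h k l γ₁ γ₂ hγ
      obtain ⟨h', rfl⟩ := ITerm.by_.inj h
      -- Peeling the warp from both results and from both environments with the same indices i and j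
      -- leaves the relation for the bodies at those steps.
      exact rel_warp_left.2 fun i hi => rel_warp_right.2 fun j hj =>
        ih₁ d₂ _ _ _ h' _ _ _ _ fun x y hxy =>
          rel_warp_right.1 (rel_warp_left.1 (hγ x y hxy) i hi) j hj
    | _ => intro m σ₁ σ₂ h; simp [ETerm.erase, ITerm.rename] at h

end WarpCalculus

theorem mainTheorem2 {G : Type v} {S : G → Type u} {n : ℕ} (Γ : WarpCalculus.Ctx G n)
    (t : WarpCalculus.ITerm S n) (e₁ e₂ : WarpCalculus.ETerm S n) (τ : WarpCalculus.Ty G)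
    (h₁ : WarpCalculus.Refines e₁ t) (h₂ : WarpCalculus.Refines e₂ t)
    (d₁ : WarpCalculus.Typing Γ e₁ τ) (d₂ : WarpCalculus.Typing Γ e₂ τ) :
    d₁.sem = d₂.sem := by
  apply NatTrans.ext
  funext k
  apply ConcreteCategory.hom_ext
  intro γ
  -- With identity renamings, only equal variables have to be compared, and γ is related to itself.
  have H := WarpCalculus.sim d₁ d₂ n id id (congrArg _ (Eq.trans h₁ h₂.symm)) k.unop k.unop γ γ
    fun x y hxy => by
      obtain rfl : x = y := hxy
      exact WarpCalculus.rel_self.2 fun _ _ _ => rfl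
  have := WarpCalculus.rel_self.1 H k.unop le_rfl le_rfl
  rwa [WarpCalculus.Trees.res_refl, WarpCalculus.Trees.res_refl] at this
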